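/- Let $\alpha>-1/2$, and let $G_m^{(\alpha)}$ be the Gegenbauer polynomials normalized by $G_0^{(\alpha)}=1$, $G_1^{(\alpha)}(x)=x$, $(m+2\alpha)G_{m+1}^{(\alpha)}=2(m+\alpha)xG_m^{(\alpha)}-mG_{m-1}^{(\alpha)}$ $(m\ge 1)$. For $n\ge 0$ let $q_n^{(\alpha)}=G_{n+1}^{(\alpha)}-G_n^{(\alpha)}$, let $t_0>t_1>\dots>t_n$ be its zeros, and for $b>0$ put $x_i=\frac b2(t_i+1)\in(0,b]$ (the shifted flipped-Gegenbauer-Gauss-Radau nodes) and $q_{b,n}^{(\alpha)}(x)=q_n^{(\alpha)}(2x/b-1)$. Let $L_k$ be the Lagrange basis polynomials at $t_0,\dots,t_n$, and define the integration matrices $Q^{(1)}_{b,i,k}=\frac b2\int_{-1}^{t_i}L_k(t)\,dt$, $Q^{(2)}_{b,i,k}=(x_i-x_k)Q^{(1)}_{b,i,k}$, $0\le i,k\le n$. Consider the linear Lane-Emden problem $$y''+\tfrac{\alpha_2}{x}y'+p(x)y=g(x)\ \text{ on }(0,b],\qquad y'(0)=\alpha_1,\qquad \beta y(b)+\gamma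 y'(b)=\delta,$$ with $\beta\neq0$ and $|p|\le M$ on $(0,b]$ (for instance $M=\|p\|_{\infty,(0,b]}$), and let $y$ be a solution. For a vector $\Phi\in\mathbb R^{n+1}$ of second-derivative values put $$y''_{\mathrm{app},n}(x_i)=\Phi_i,\qquad y'_{\mathrm{app},n}(x_i)=\alpha_1+(Q_b^{(1)}\Phi)_i,$$ $$y_{\mathrm{app},n}(x_i)=\tfrac1\beta(\delta-\gamma\alpha_1)+\alpha_1(x_i-b)+(Q_b^{(2)}\Phi)_i-(Q_b^{(2)}\Phi)_0-\tfrac\gamma\beta(Q_b^{(1)}\Phi)_0,$$ $$\mathcal R(x_i)=y''_{\mathrm{app},n}(x_i)+\tfrac{\alpha_2}{x_i}y'_{\mathrm{app},n}(x_i)+p(x_i)\,y_{\mathrm{app},n}(x_i)-g(x_i),\qquad i=0,\dots,n.$$ Let $\Phi$ be either the vector $(y''(x_i))_i$ of exact nodal values, or a solution of the linear collocation system $\mathcal A\Phi=\mathcal B$, where $\mathcal A=I+\alpha_2D_{1/x}Q_b^{(1)}+D_{p(x)}\Theta$, $\Theta_{i,k}=Q^{(2)}_{b,i,k}-Q^{(2)}_{b,0,k}-\frac\gamma\beta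 Q^{(1)}_{b,0,k}$ and $\mathcal B_i=g(x_i)-\frac{\alpha_1\alpha_2}{x_i}-p(x_i)\big(\frac1\beta(\delta-\gamma\alpha_1)+\alpha_1(x_i-b)\big)$; here $D_v$ is the diagonal matrix with diagonal $v$. Then the following hold. (i) Let $n\ge0$, let $y$ be $(n+3)$ times continuously differentiable on $(0,b]$, and let $|y^{(n+k+2)}|\le A_k$ on $(0,b]$ for $k=0,1$ (for instance $A_k=\|y^{(n+k+2)}\|_{\infty,(0,b]}$). Then for $i=0,\dots,n$ $$|\mathcal R(x_i)|\le\frac{2^{-2n-1}\|q_{b,n}^{(\alpha)}\|_{\infty,(0,b]}\,\Gamma(\alpha+1)\,b^{n+1}\,\Gamma(n+2\alpha+1)}{(n+1)!\,\Gamma(2\alpha+1)\,\Gamma(n+\alpha+1)}\Big(A_1\big(bM(x_i+|\tfrac\gamma\beta|+b)+|\alpha_2|\big)+A_0M(n+1)(x_i+b)\Big).$$ (ii) There are positive constants $\mathcal L_1$ (if $\alpha\ge0$) and $\mathcal L_2$ (if $\alpha<0$), depending only on $\alpha$, $M$ and $b$, such that for every problem and solution as above with $y$ infinitely differentiable on $(0,b]$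 and with constants $A_0,A_1$ independent of $n$ such that $|y^{(n+2)}|\le A_0$ and $|y^{(n+3)}|\le A_1$ on $(0,b]$ for all sufficiently large $n$, one has for all sufficiently large $n$ (how large may depend on the problem, on $y$ and on $A_0,A_1$), all such $\Phi$ and all $i=0,\dots,n$: if $\alpha\ge0$, $$|\mathcal R(x_i)|\le\mathcal L_1\Big(\frac e4\Big)^nb^{n+1}\begin{cases}n^{-n-\frac32+\alpha},&A_0=0,\\ n^{-n-\frac12+\alpha},&A_0\ne0,\end{cases}$$ and if $-\frac12<\alpha<0$, $$|\mathcal R(x_i)|\le\mathcal L_2\Big(\frac e4\Big)^nb^{n+1}\begin{cases}n^{-n-\frac32},&A_0=0,\\ n^{-n-\frac12},&A_0\ne0.\end{cases}$$ -/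

import Mathlib

open Polynomial Set Filter MeasureTheory

namespace SGIPSM

noncomputable section

/-- The Gegenbauer polynomial `G_n^{(α)}`, standardized by `G_n^{(α)}(1) = 1`:
`G_0 = 1`, `G_1 = x`, `(m + 2α) G_{m+1} = 2 (m + α) x G_m - m G_{m-1}` for `m ≥ 1`. -/
def gegenbauer (α : ℝ) : ℕ → ℝ[X]
  | 0 => 1
  | 1 => X
  | n + 2 =>
      C (((n : ℝ) + 1 + 2 * α)⁻¹) *
        (C (2 * ((n : ℝ) + 1 + α)) * X * gegenbauer α (n + 1)
          - C ((n : ℝ) + 1) * gegenbauer α n)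

/-- `q_n^{(α)} = G_{n+1}^{(α)} - G_n^{(α)}`. -/
def radauPoly (α : ℝ) (n : ℕ) : ℝ[X] := gegenbauer α (n + 1) - gegenbauer α n

/-- The flipped-Gegenbauer-Gauss-Radau nodes: the `n + 1` zeros of `q_n^{(α)}`, sorted in
descending order (they are real and simple). -/
def node (α : ℝ) (n : ℕ) (k : Fin (n + 1)) : ℝ :=
  ((radauPoly α n).roots.sort (· ≥ ·)).getD k 0

/-- The shifted nodes on `(0, b]`. -/
def snode (b α : ℝ) (n : ℕ) (k : Fin (n + 1)) : ℝ := b / 2 * (node α n k + 1)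

/-- The first-order integration matrix at the nodes: it maps the vector of values of a function
at the nodes to the vector of the integrals over `[-1, x_i]` of its interpolating polynomial of
degree at most `n` at the nodes. -/
def Q1 (α : ℝ) (n : ℕ) : Matrix (Fin (n + 1)) (Fin (n + 1)) ℝ :=
  Matrix.of fun i k =>
    ∫ x in (-1 : ℝ)..(node α n i), (Lagrange.basis Finset.univ (node α n) k).eval x

/-- The first-order shifted integration matrix. -/
def Qb1 (b α : ℝ) (n : ℕ) : Matrix (Fin (n + 1)) (Fin (n + 1)) ℝ := (b / 2) • Q1 α n

/-- The second-order shifted integration matrix. -/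
def Qb2 (b α : ℝ) (n : ℕ) : Matrix (Fin (n + 1)) (Fin (n + 1)) ℝ :=
  Matrix.of fun i k => (snode b α n i - snode b α n k) * Qb1 b α n i k

/-- The uniform norm of a real function on a set (used for functions bounded on the set). -/
def supNorm (f : ℝ → ℝ) (S : Set ℝ) : ℝ := sSup ((fun x => |f x|) '' S)

/-- The data of the linear Lane-Emden problem
`y'' + (α₂ / x) y' + p y = g` on `(0, b]`, `y'(0) = α₁`, `β y(b) + γ y'(b) = δ`. -/
structure Problem where
  b : ℝ
  α₁ : ℝ
  α₂ : ℝ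
  β : ℝ
  γ : ℝ
  δ : ℝ
  p : ℝ → ℝ
  g : ℝ → ℝ

/-- The `m`-th derivative of `y` on `(0, b]` (one-sided at `b`). -/
def der (b : ℝ) (m : ℕ) (y : ℝ → ℝ) : ℝ → ℝ := iteratedDerivWithin m y (Ioc 0 b)

namespace Problem

/-- `y` solves the problem. The existence of the derivatives on `(0, b]` is a separate
differentiability requirement. -/
structure IsSolution (P : Problem) (y : ℝ → ℝ) : Prop where
  ode : ∀ x ∈ Ioc 0 P.b,
    der P.b 2 y x + P.α₂ / x * der P.b 1 y x + P.p x * y x = P.g x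
  neumann : HasDerivWithinAt y P.α₁ (Icc 0 P.b) 0
  robin : P.β * y P.b + P.γ * der P.b 1 y P.b = P.δ

variable (P : Problem) (α : ℝ) (n : ℕ)

/-- The matrix `H = I + α₂ D_{1/x} Q_b^{(1)}`. -/
def H : Matrix (Fin (n + 1)) (Fin (n + 1)) ℝ :=
  1 + P.α₂ • (Matrix.diagonal (fun i => (snode P.b α n i)⁻¹) * Qb1 P.b α n)

/-- The vector `x̄ = (δ - γ α₁) / β + α₁ (x - b)`. -/
def xbar : Fin (n + 1) → ℝ :=
  fun i => 1 / P.β * (P.δ - P.γ * P.α₁) + P.α₁ * (snode P.b α n i - P.b)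

/-- The matrix `Θ`: the row `Q_{b,0}^{(2)} + (γ/β) Q_{b,0}^{(1)}` is subtracted from every row
of `Q_b^{(2)}`. -/
def Theta : Matrix (Fin (n + 1)) (Fin (n + 1)) ℝ :=
  Matrix.of fun i k =>
    Qb2 P.b α n i k - (Qb2 P.b α n 0 k + P.γ / P.β * Qb1 P.b α n 0 k)

/-- The coefficient matrix of the collocation system. -/
def sysMat : Matrix (Fin (n + 1)) (Fin (n + 1)) ℝ :=
  P.H α n + Matrix.diagonal (fun i => P.p (snode P.b α n i)) * P.Theta α n

/-- The right-hand side of the collocation system. -/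
def sysRhs : Fin (n + 1) → ℝ :=
  fun i => P.g (snode P.b α n i) - P.α₁ * P.α₂ * (snode P.b α n i)⁻¹
    - P.p (snode P.b α n i) * P.xbar α n i

variable {α n}

/-- Nodal values of `y_app''`, given the vector `Φ` of second-derivative values. -/
def app2 (_P : Problem) (Φ : Fin (n + 1) → ℝ) : Fin (n + 1) → ℝ := Φ

variable (α)

/-- Nodal values of `y_app'`: `α₁ + Q_b^{(1)} Φ`. -/
def app1 (Φ : Fin (n + 1) → ℝ) : Fin (n + 1) → ℝ :=
  fun i => P.α₁ + (Qb1 P.b α n).mulVec Φ i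

/-- Nodal values of `y_app`: `x̄ + Θ Φ`. -/
def app0 (Φ : Fin (n + 1) → ℝ) : Fin (n + 1) → ℝ :=
  fun i => P.xbar α n i + (P.Theta α n).mulVec Φ i

/-- The residual `y_app'' + (α₂ / x) y_app' + p y_app - g` at the node with index `i`. -/
def residual (Φ : Fin (n + 1) → ℝ) (i : Fin (n + 1)) : ℝ :=
  P.app2 Φ i + P.α₂ / snode P.b α n i * P.app1 α Φ i
    + P.p (snode P.b α n i) * P.app0 α Φ i - P.g (snode P.b α n i)

/-- `Φ` is a vector of second-derivative values of the method for the solution `y`: either the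
vector `y''(x_i)` of the nodal values of `y''`, or a solution of the collocation system. -/
def IsNodalVector (y : ℝ → ℝ) (Φ : Fin (n + 1) → ℝ) : Prop :=
  (∀ i, Φ i = der P.b 2 y (snode P.b α n i)) ∨ (P.sysMat α n).mulVec Φ = P.sysRhs α n

end Problem

/-- The explicit bound for the residual at a node `x`. -/
def explicitBound (P : Problem) (α : ℝ) (n : ℕ) (M A₀ A₁ x : ℝ) : ℝ :=
  (2 : ℝ) ^ (-2 * (n : ℤ) - 1)
      * supNorm (fun t => (radauPoly α n).eval (2 * t / P.b - 1)) (Ioc 0 P.b)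
      * Real.Gamma (α + 1) * P.b ^ (n + 1) * Real.Gamma (n + 2 * α + 1)
      / ((n + 1).factorial * Real.Gamma (2 * α + 1) * Real.Gamma (n + α + 1))
    * (A₁ * (P.b * M * (x + |P.γ / P.β| + P.b) + |P.α₂|)
        + A₀ * M * (n + 1) * (x + P.b))

end

end SGIPSM

/-! A solution of the collocation system has zero residual at every node
(`residual_eq_zero_of_system`), so only the exact nodal values of y'' need work. For them
`Q_b^{(1)}` integrates the interpolant I of y'' (`Qb1_mulVec`). `Q_b^{(2)}` integrates (x_i - s)
I(s) and adds the degree-n coefficient of I times the integral of the nodal polynomial, because (x_i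
- X) I has degree up to n + 1 and must be reduced to degree n (`interpolate_sub_mul`, `Qb2_mulVec`).
After comparison with y' = α₁ + ∫ y'' and with Taylor's formula at 0, the differential equation and
the Robin condition at x_0 = b cancel everything except integrals of y'' - I and the nodal term
(`abs_residual_le_of_nodal`). Iterated Rolle bounds y'' - I by A₁/(n+1)! times the nodal polynomial,
and the coefficient by A₀/n!. The nodal polynomial is q_n rescaled and divided by its leading
coefficient, a quotient of Gamma values; estimating its integral by supremum times length gives (i).

For (ii) the constants may not depend on α₂, γ/β, A₀ or A₁, so (i) alone is not enough. The extra
input is that integrating q_n over [-1, t] gains a factor 1/n (`derivative_gegenbauer_sub`,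
`exists_radauPoly_bounds`). With Stirling, a harmonic-sum bound for the leading coefficient and a
bound G_n = O(n^σ), the residual is O(n^(-n - 1/2 + α + σ - 1) (e/4)^n b^(n+1)). The Sonine energy
gives σ = 0 for α ≥ 0 and σ = 1 for α < 0; in both cases this is of strictly smaller order than the
claimed rate, so every problem-dependent factor is absorbed for large n. If A₀ = 0, all high
derivatives vanish and (i) gives residual zero. -/

namespace SGIPSM

/-! ### Algebra of Gegenbauer polynomials: recurrences, leading coefficient, antiderivative. -/

section Gegenbauer

variable {α : ℝ}

theorem gegenbauer_recurrence_poly (hα : -1 / 2 < α) (m : ℕ) :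
    C ((m : ℝ) + 1 + 2 * α) * gegenbauer α (m + 2) =
      C (2 * ((m : ℝ) + 1 + α)) * X * gegenbauer α (m + 1) - C ((m : ℝ) + 1) * gegenbauer α m := by
  have h : (m : ℝ) + 1 + 2 * α ≠ 0 := by
    have := Nat.cast_nonneg (α := ℝ) m
    linarith
  rw [gegenbauer, ← mul_assoc, ← C_mul, mul_inv_cancel₀ h, C_1, one_mul]

theorem gegenbauer_recurrence (hα : -1 / 2 < α) (m : ℕ) (x : ℝ) :
    ((m : ℝ) + 1 + 2 * α) * (gegenbauer α (m + 2)).eval x =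
      2 * ((m : ℝ) + 1 + α) * x * (gegenbauer α (m + 1)).eval x
        - ((m : ℝ) + 1) * (gegenbauer α m).eval x := by
  have h := congrArg (eval x) (gegenbauer_recurrence_poly hα m)
  simpa only [eval_mul, eval_sub, eval_C, eval_X] using h

theorem derivative_gegenbauer_recurrence (hα : -1 / 2 < α) (m : ℕ) (x : ℝ) :
    ((m : ℝ) + 1 + 2 * α) * (gegenbauer α (m + 2)).derivative.eval x =
      2 * ((m : ℝ) + 1 + α) * ((gegenbauer α (m + 1)).eval x
        + x * (gegenbauer α (m + 1)).derivative.eval x)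
        - ((m : ℝ) + 1) * (gegenbauer α m).derivative.eval x := by
  have h := congrArg (fun p => eval x (derivative p)) (gegenbauer_recurrence_poly hα m)
  simp only [derivative_mul, derivative_sub, derivative_C, derivative_X, zero_mul, zero_add,
    mul_one, eval_mul, eval_sub, eval_add, eval_C, eval_X] at h
  rw [h]
  ring

theorem gegenbauer_eval_one (hα : -1 / 2 < α) (m : ℕ) : (gegenbauer α m).eval 1 = 1 := by
  induction m using Nat.twoStepInduction with
  | zero => simp [gegenbauer]
  | one => simp [gegenbauer]
  | more m h0 h1 =>
    have h := gegenbauer_recurrence hα m 1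
    have hm : (0 : ℝ) < (m : ℝ) + 1 + 2 * α := by
      have := Nat.cast_nonneg (α := ℝ) m
      linarith
    rw [h0, h1] at h
    refine mul_left_cancel₀ hm.ne' (h.trans ?_)
    ring

theorem gegenbauer_eval_neg (hα : -1 / 2 < α) (m : ℕ) (x : ℝ) :
    (gegenbauer α m).eval (-x) = (-1) ^ m * (gegenbauer α m).eval x := by
  induction m using Nat.twoStepInduction with
  | zero => simp [gegenbauer]
  | one => simp [gegenbauer]
  | more m h0 h1 =>
    have h := gegenbauer_recurrence hα m (-x)
    have h' := gegenbauer_recurrence hα m x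
    have hm : (0 : ℝ) < (m : ℝ) + 1 + 2 * α := by
      have := Nat.cast_nonneg (α := ℝ) m
      linarith
    rw [h0, h1] at h
    refine mul_left_cancel₀ hm.ne' (h.trans ?_)
    linear_combination (-(-1) ^ m) * h'

/-- The leading coefficient of the Gegenbauer polynomial of degree `n + 1`. -/
noncomputable def gegenbauerLead (α : ℝ) (n : ℕ) : ℝ :=
  ∏ m ∈ Finset.range n, (2 * ((m : ℝ) + 1 + α) / ((m : ℝ) + 1 + 2 * α))

theorem gegenbauerLead_pos (hα : -1 / 2 < α) (n : ℕ) : 0 < gegenbauerLead α n := by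
  refine Finset.prod_pos fun m _ => ?_
  have := Nat.cast_nonneg (α := ℝ) m
  apply div_pos <;> linarith

theorem natDegree_gegenbauer_le (n : ℕ) : (gegenbauer α n).natDegree ≤ n := by
  induction n using Nat.twoStepInduction with
  | zero => simp [gegenbauer]
  | one => simp [gegenbauer]
  | more m h0 h1 =>
    rw [gegenbauer]
    refine (natDegree_C_mul_le _ _).trans ((natDegree_sub_le _ _).trans (max_le ?_ ?_))
    · rw [mul_assoc]
      refine (natDegree_C_mul_le _ _).trans (natDegree_mul_le.trans ?_)
      rw [natDegree_X]
      omega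
    · exact (natDegree_C_mul_le _ _).trans (h0.trans (by omega))

theorem coeff_gegenbauer_succ (n : ℕ) :
    (gegenbauer α (n + 1)).coeff (n + 1) = gegenbauerLead α n := by
  induction n with
  | zero => simp [gegenbauer, gegenbauerLead]
  | succ m ih =>
    have h0 : (gegenbauer α m).coeff (m + 2) = 0 :=
      coeff_eq_zero_of_natDegree_lt ((natDegree_gegenbauer_le m).trans_lt (by omega))
    rw [gegenbauer, coeff_C_mul, coeff_sub, coeff_C_mul, h0, mul_assoc, coeff_C_mul, coeff_X_mul,
      ih, gegenbauerLead, gegenbauerLead, Finset.prod_range_succ]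
    ring

theorem gegenbauerLead_eq_Gamma (hα : -1 / 2 < α) (n : ℕ) :
    gegenbauerLead α n = 2 ^ n * Real.Gamma (n + α + 1) * Real.Gamma (2 * α + 1) /
      (Real.Gamma (α + 1) * Real.Gamma (n + 2 * α + 1)) := by
  have hG : ∀ z : ℝ, 0 < z → Real.Gamma z ≠ 0 := fun z hz => (Real.Gamma_pos_of_pos hz).ne'
  induction n with
  | zero =>
    simp only [gegenbauerLead, Finset.range_zero, Finset.prod_empty, pow_zero, Nat.cast_zero,
      zero_add, one_mul]
    rw [div_self]
    exact mul_ne_zero (hG _ (by linarith)) (hG _ (by linarith))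
  | succ m ih =>
    have hm := Nat.cast_nonneg (α := ℝ) m
    rw [gegenbauerLead, Finset.prod_range_succ, ← gegenbauerLead, ih]
    push_cast
    rw [show (m : ℝ) + 1 + α + 1 = (m + α + 1) + 1 by ring,
      show (m : ℝ) + 1 + 2 * α + 1 = (m + 2 * α + 1) + 1 by ring,
      Real.Gamma_add_one (s := m + α + 1) (by linarith),
      Real.Gamma_add_one (s := m + 2 * α + 1) (by linarith)]
    have h1 := hG (m + 2 * α + 1) (by linarith)
    have h2 := hG (α + 1) (by linarith)
    have h3 : (m : ℝ) + 2 * α + 1 ≠ 0 := by linarith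
    have h4 : (m : ℝ) + 1 + 2 * α ≠ 0 := by linarith
    field_simp
    ring

/-- Both first-order differential-difference relations. -/
theorem derivative_gegenbauer_relations (hα : -1 / 2 < α) (m : ℕ) (x : ℝ) :
    (1 - x ^ 2) * (gegenbauer α m).derivative.eval x =
      (m + 2 * α) * (x * (gegenbauer α m).eval x - (gegenbauer α (m + 1)).eval x) ∧
    (1 - x ^ 2) * (gegenbauer α (m + 1)).derivative.eval x =
      (m + 1) * ((gegenbauer α m).eval x - x * (gegenbauer α (m + 1)).eval x) := by
  induction m with
  | zero =>
    constructor
    · simp [gegenbauer]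
    · simp [gegenbauer]
      ring
  | succ m ih =>
    obtain ⟨h1, h2⟩ := ih
    have hm : (0 : ℝ) < (m : ℝ) + 1 + 2 * α := by
      have := Nat.cast_nonneg (α := ℝ) m
      linarith
    have r := gegenbauer_recurrence hα m x
    have d := derivative_gegenbauer_recurrence hα m x
    push_cast
    constructor
    · linear_combination h2 + r
    · refine mul_left_cancel₀ hm.ne' ?_
      linear_combination (1 - x ^ 2) * d + 2 * (m + 1 + α) * x * h2 - (m + 1) * h1
        + (m + 2) * x * r

/-- This antiderivative is the source of the 1/n gain in the asymptotic bound: its coefficients stay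
bounded while the factor on the right grows with m. It follows from the two differential-difference
relations after multiplication by 1 - X², which cancels in the polynomial ring. -/
theorem derivative_gegenbauer_sub (hα : -1 / 2 < α) (m : ℕ) :
    derivative (C (((m : ℝ) + 2 + 2 * α) / (m + 3)) * gegenbauer α (m + 3)
      - C (((m : ℝ) + 2) / (m + 1 + 2 * α)) * gegenbauer α (m + 1)) =
      C (2 * (m + 2 + α)) * gegenbauer α (m + 2) := by
  have hm : (0 : ℝ) < (m : ℝ) + 1 + 2 * α := by
    have := Nat.cast_nonneg (α := ℝ) m
    linarith
  have hm' : (0 : ℝ) < (m : ℝ) + 3 := by positivity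
  have h0 : (1 - X ^ 2 : ℝ[X]) ≠ 0 := by
    intro h
    have := congrArg (eval 0) h
    simp at this
  refine mul_left_cancel₀ h0 (Polynomial.funext fun x => ?_)
  have h1 := (derivative_gegenbauer_relations hα (m + 2) x).2
  have h2 := (derivative_gegenbauer_relations hα (m + 1) x).1
  have r := gegenbauer_recurrence hα (m + 1) x
  push_cast at h1 h2 r
  simp only [derivative_sub, derivative_mul, derivative_C, zero_mul, zero_add, eval_mul, eval_sub,
    eval_one, eval_pow, eval_X, eval_C]
  have ha : ((m : ℝ) + 2 + 2 * α) / (m + 3) * (m + 3) = m + 2 + 2 * α :=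
    div_mul_cancel₀ _ hm'.ne'
  have hc : ((m : ℝ) + 2) / (m + 1 + 2 * α) * (m + 1 + 2 * α) = m + 2 := div_mul_cancel₀ _ hm.ne'
  linear_combination ((m : ℝ) + 2 + 2 * α) / (m + 3) * h1 - ((m : ℝ) + 2) / (m + 1 + 2 * α) * h2
    + ((gegenbauer α (m + 2)).eval x - x * (gegenbauer α (m + 3)).eval x) * ha
    - (x * (gegenbauer α (m + 1)).eval x - (gegenbauer α (m + 2)).eval x) * hc - x * r

end Gegenbauer

/-! ### Uniform bounds on [-1, 1] through the Sonine energy. -/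

section GegenbauerBound

variable {α : ℝ}

/-- Differentiating one first-order relation and eliminating G_m and its derivative with both
relations yields the ODE, up to a factor 1 - X² that is cancelled. -/
theorem gegenbauer_ode (hα : -1 / 2 < α) (m : ℕ) (x : ℝ) :
    (1 - x ^ 2) * (gegenbauer α (m + 1)).derivative.derivative.eval x =
      (2 * α + 1) * x * (gegenbauer α (m + 1)).derivative.eval x
        - (m + 1) * (m + 1 + 2 * α) * (gegenbauer α (m + 1)).eval x := by
  have hd : (1 - X ^ 2 : ℝ[X]) * derivative (gegenbauer α (m + 1)) =
      C ((m : ℝ) + 1) * (gegenbauer α m - X * gegenbauer α (m + 1)) := by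
    refine Polynomial.funext fun x => ?_
    simpa using (derivative_gegenbauer_relations hα m x).2
  suffices h : (1 - X ^ 2 : ℝ[X]) * derivative (derivative (gegenbauer α (m + 1))) =
      C (2 * α + 1) * X * derivative (gegenbauer α (m + 1))
        - C (((m : ℝ) + 1) * (m + 1 + 2 * α)) * gegenbauer α (m + 1) by
    simpa using congrArg (eval x) h
  have h0 : (1 - X ^ 2 : ℝ[X]) ≠ 0 := by
    intro h
    have := congrArg (eval 0) h
    simp at this
  refine mul_left_cancel₀ h0 (Polynomial.funext fun x => ?_)
  have h1 := congrArg (fun p => eval x (derivative p)) hd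
  obtain ⟨h2, h3⟩ := derivative_gegenbauer_relations hα m x
  simp only [derivative_mul, derivative_sub, derivative_one, derivative_X_pow, derivative_C,
    derivative_X, eval_mul, eval_sub, eval_add, eval_C, eval_X, eval_pow, eval_one,
    eval_zero, zero_mul, zero_add, one_mul] at h1 ⊢
  norm_num at h1
  linear_combination (1 - x ^ 2) * h1 + ((m : ℝ) + 1) * h2 - (m + 2 * α) * x * h3

/-- The Sonine energy of the Gegenbauer polynomial of degree `m + 1`. -/
noncomputable def sonine (α : ℝ) (m : ℕ) : ℝ[X] :=
  C (((m : ℝ) + 1) * (m + 1 + 2 * α)) * gegenbauer α (m + 1) ^ 2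
    + (1 - X ^ 2) * derivative (gegenbauer α (m + 1)) ^ 2

/-- The ODE cancels every term without a factor α, so the sign of α decides whether the energy
increases or decreases on [0, 1]. -/
theorem derivative_sonine (hα : -1 / 2 < α) (m : ℕ) (x : ℝ) :
    (derivative (sonine α m)).eval x =
      4 * α * x * (gegenbauer α (m + 1)).derivative.eval x ^ 2 := by
  have h := gegenbauer_ode hα m x
  simp [sonine, derivative_pow]
  linear_combination 2 * (gegenbauer α (m + 1)).derivative.eval x * h

theorem sq_gegenbauer_le_sonine (m : ℕ) {x : ℝ} (hx : x ∈ Icc (0 : ℝ) 1) :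
    ((m : ℝ) + 1) * (m + 1 + 2 * α) * (gegenbauer α (m + 1)).eval x ^ 2 ≤ (sonine α m).eval x := by
  have h : 0 ≤ (1 - x ^ 2) * (gegenbauer α (m + 1)).derivative.eval x ^ 2 :=
    mul_nonneg (by nlinarith [hx.1, hx.2]) (sq_nonneg _)
  simp [sonine]
  linarith

theorem abs_gegenbauer_le_of_forall_nonneg (hα : -1 / 2 < α) (n : ℕ) {B : ℝ}
    (h : ∀ x ∈ Icc (0 : ℝ) 1, |(gegenbauer α n).eval x| ≤ B) :
    ∀ x ∈ Icc (-1 : ℝ) 1, |(gegenbauer α n).eval x| ≤ B := by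
  intro x hx
  rcases le_total 0 x with h0 | h0
  · exact h x ⟨h0, hx.2⟩
  · have := h (-x) ⟨by linarith, by linarith [hx.1]⟩
    rwa [gegenbauer_eval_neg hα, abs_mul, abs_pow, abs_neg, abs_one, one_pow, one_mul] at this

/-- The energy increases on [0, 1], and at 1 its derivative term vanishes; parity covers [-1, 0]. -/
theorem abs_gegenbauer_le_one (hα : 0 ≤ α) (n : ℕ) :
    ∀ x ∈ Icc (-1 : ℝ) 1, |(gegenbauer α n).eval x| ≤ 1 := by
  have hα' : -1 / 2 < α := by linarith
  refine abs_gegenbauer_le_of_forall_nonneg hα' n fun x hx => ?_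
  rcases n with _ | m
  · simp [gegenbauer]
  have hmono : MonotoneOn (fun x => (sonine α m).eval x) (Icc 0 1) := by
    refine monotoneOn_of_deriv_nonneg (convex_Icc 0 1) (sonine α m).continuous.continuousOn
      (sonine α m).differentiable.differentiableOn fun t ht => ?_
    rw [interior_Icc] at ht
    rw [Polynomial.deriv, derivative_sonine hα']
    have := ht.1
    positivity
  have h1 := hmono hx (right_mem_Icc.2 zero_le_one) hx.2
  have h2 := sq_gegenbauer_le_sonine (α := α) m hx
  have h3 : (sonine α m).eval 1 = ((m : ℝ) + 1) * (m + 1 + 2 * α) := by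
    simp [sonine, gegenbauer_eval_one hα']
  have hN : (0 : ℝ) < ((m : ℝ) + 1) * (m + 1 + 2 * α) := by positivity
  simp only [h3] at h1
  rw [← sq_le_one_iff_abs_le_one]
  refine le_of_mul_le_mul_left ?_ hN
  linarith

theorem abs_gegenbauer_zero_le (hα : -1 / 2 < α) (hα' : α < 0) (n : ℕ) :
    |(gegenbauer α n).eval 0| ≤ 1 / (1 + 2 * α) * (n + 1) := by
  have hd : 0 < 1 + 2 * α := by linarith
  have hC : 1 ≤ 1 / (1 + 2 * α) := by
    rw [le_div_iff₀ hd]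
    linarith
  induction n using Nat.twoStepInduction with
  | zero => simpa [gegenbauer] using hC
  | one => simp [gegenbauer]; positivity
  | more m h0 _ =>
    have hm := Nat.cast_nonneg (α := ℝ) m
    have hm1 : (0 : ℝ) < (m : ℝ) + 1 + 2 * α := by linarith
    have r := gegenbauer_recurrence hα m 0
    have r' : (gegenbauer α (m + 2)).eval 0 =
        -(((m : ℝ) + 1) / ((m : ℝ) + 1 + 2 * α)) * (gegenbauer α m).eval 0 := by
      field_simp
      linarith
    have hp : 0 ≤ ((m : ℝ) + 1) / ((m : ℝ) + 1 + 2 * α) := by positivity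
    rw [r', abs_mul, abs_neg, abs_of_nonneg hp]
    -- The induction needs (m+1)² ≤ (m+3)(m+1+2α), which 2α > -1 guarantees only from m = 1 on. For
    -- m = 0 the factor 1/(1+2α) is the constant itself.
    rcases m with _ | m
    · simp [gegenbauer]
      rw [inv_eq_one_div]
      linarith
    · refine (mul_le_mul_of_nonneg_left h0 hp).trans ?_
      push_cast at hm1 ⊢
      have hm0 := Nat.cast_nonneg (α := ℝ) m
      rw [mul_left_comm]
      refine mul_le_mul_of_nonneg_left ?_ (by positivity)
      rw [div_mul_eq_mul_div, div_le_iff₀ hm1]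
      nlinarith

/-- The energy now decreases on [0, 1], so its value at 0 controls everything, and there the
recurrence gives linear growth. This suffices because α < 0 supplies the strict gap in the final
exponent. -/
theorem exists_abs_gegenbauer_le (hα : -1 / 2 < α) (hα' : α < 0) :
    ∃ D : ℝ, 0 < D ∧ ∀ n : ℕ, ∀ x ∈ Icc (-1 : ℝ) 1,
      |(gegenbauer α n).eval x| ≤ D * (n + 1) := by
  have hd : 0 < 1 + 2 * α := by linarith
  set c := 1 / (1 + 2 * α) with hc
  have hC : 1 ≤ c := by
    rw [hc, le_div_iff₀ hd]
    linarith
  -- The energy estimate produces (1 + c) c² (n+1)², which is at most (2c²(n+1))² because c ≥ 1.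
  refine ⟨2 * c ^ 2, by positivity, fun n => ?_⟩
  refine abs_gegenbauer_le_of_forall_nonneg hα n fun x hx => ?_
  rcases n with _ | m
  · simp [gegenbauer]
    nlinarith
  have hm := Nat.cast_nonneg (α := ℝ) m
  have hmono : AntitoneOn (fun x => (sonine α m).eval x) (Icc 0 1) := by
    refine antitoneOn_of_deriv_nonpos (convex_Icc 0 1) (sonine α m).continuous.continuousOn
      (sonine α m).differentiable.differentiableOn fun t ht => ?_
    rw [interior_Icc] at ht
    rw [Polynomial.deriv, derivative_sonine hα]
    exact mul_nonpos_of_nonpos_of_nonneg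
      (mul_nonpos_of_nonpos_of_nonneg (by linarith) ht.1.le) (sq_nonneg _)
  have h1 := hmono (left_mem_Icc.2 zero_le_one) hx hx.1
  have h2 := sq_gegenbauer_le_sonine (α := α) m hx
  have hd0 : (gegenbauer α (m + 1)).derivative.eval 0 = (m + 1) * (gegenbauer α m).eval 0 := by
    simpa using (derivative_gegenbauer_relations hα m 0).2
  have h3 : (sonine α m).eval 0 = ((m : ℝ) + 1) * (m + 1 + 2 * α) *
      (gegenbauer α (m + 1)).eval 0 ^ 2 + ((m + 1) * (gegenbauer α m).eval 0) ^ 2 := by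
    simp [sonine, hd0]
  have hN1 : (0 : ℝ) < (m : ℝ) + 1 + 2 * α := by linarith
  have hN : (0 : ℝ) < ((m : ℝ) + 1) * (m + 1 + 2 * α) := by positivity
  have h4 : (m : ℝ) + 1 ≤ c * (m + 1 + 2 * α) := by
    rw [hc, div_mul_eq_mul_div, one_mul, le_div_iff₀ hd]
    nlinarith
  have g0 := sq_le_sq' (by linarith [(abs_le.1 (abs_gegenbauer_zero_le hα hα' m)).1])
    (abs_le.1 (abs_gegenbauer_zero_le hα hα' m)).2
  have g1 := sq_le_sq' (by linarith [(abs_le.1 (abs_gegenbauer_zero_le hα hα' (m + 1))).1])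
    (abs_le.1 (abs_gegenbauer_zero_le hα hα' (m + 1))).2
  rw [← hc] at g0 g1
  push_cast at g1 ⊢
  simp only [h3] at h1
  refine abs_le_of_sq_le_sq ?_ (by positivity)
  have h5 : (gegenbauer α (m + 1)).eval x ^ 2 ≤
      (gegenbauer α (m + 1)).eval 0 ^ 2 + c * (gegenbauer α m).eval 0 ^ 2 := by
    refine le_of_mul_le_mul_left (h2.trans (h1.trans ?_)) hN
    have : ((m : ℝ) + 1) * (m + 1) * (gegenbauer α m).eval 0 ^ 2 ≤
        (m + 1) * (c * (m + 1 + 2 * α)) * (gegenbauer α m).eval 0 ^ 2 := by gcongr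
    linarith
  have h6 : (c * ((m : ℝ) + 1)) ^ 2 ≤ (c * (m + 1 + 1)) ^ 2 := by gcongr; linarith
  calc _ ≤ (c * ((m : ℝ) + 1 + 1)) ^ 2 + c * (c * ((m : ℝ) + 1 + 1)) ^ 2 := by
        refine h5.trans (add_le_add g1 (mul_le_mul_of_nonneg_left (g0.trans h6) (by linarith)))
    _ = (1 + c) * c ^ 2 * ((m : ℝ) + 1 + 1) ^ 2 := by ring
    _ ≤ (4 * c ^ 2) * c ^ 2 * ((m : ℝ) + 1 + 1) ^ 2 := by gcongr; nlinarith
    _ = _ := by ring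

end GegenbauerBound

/-! ### Zeros of G_m and of q_n; the nodes as simple roots in (-1, 1]. -/

section Nodes

variable {α : ℝ}

/-- The nodal polynomial is monic, so the top coefficients cancel; the difference has degree below
the number of points where it vanishes. -/
theorem eq_C_mul_nodal {ι : Type*} (s : Finset ι) (v : ι → ℝ) (hv : Set.InjOn v s) (p : ℝ[X])
    (hp : p.natDegree ≤ s.card) (h0 : ∀ i ∈ s, p.eval (v i) = 0) :
    p = C (p.coeff s.card) * Lagrange.nodal s v := by
  classical
  refine eq_of_degree_sub_lt_of_eval_index_eq s hv ?_ fun i hi => ?_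
  · rw [degree_lt_iff_coeff_zero]
    intro m hm
    rw [coeff_sub, coeff_C_mul]
    rcases hm.eq_or_lt with rfl | hm
    · have h1 : (Lagrange.nodal s v).coeff s.card = 1 := by
        have := (Lagrange.nodal_monic (s := s) (v := v)).coeff_natDegree
        rwa [Lagrange.natDegree_nodal] at this
      rw [h1, mul_one, sub_self]
    · rw [coeff_eq_zero_of_natDegree_lt (hp.trans_lt hm), coeff_eq_zero_of_natDegree_lt
        ((Lagrange.natDegree_nodal (s := s) (v := v)).trans_lt hm), mul_zero, sub_zero]
  · rw [h0 i hi, eval_mul, Lagrange.eval_nodal_at_node hi, mul_zero]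

theorem neg_one_pow_mul_prod_pos {u : ℕ → ℝ} {m j : ℕ} (hj : j ≤ m) {x : ℝ}
    (h1 : ∀ i < j, u i < x) (h2 : ∀ i, j ≤ i → i < m → x < u i) :
    0 < (-1) ^ (m - j) * ∏ i ∈ Finset.range m, (x - u i) := by
  obtain ⟨k, rfl⟩ := Nat.exists_eq_add_of_le hj
  rw [Finset.prod_range_add, Nat.add_sub_cancel_left, mul_left_comm]
  refine mul_pos (Finset.prod_pos fun i hi => sub_pos.2 (h1 i (Finset.mem_range.1 hi))) ?_
  have : (-1 : ℝ) ^ k * ∏ i ∈ Finset.range k, (x - u (j + i)) =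
      ∏ i ∈ Finset.range k, (u (j + i) - x) := by
    rw [show (-1 : ℝ) ^ k = ∏ _i ∈ Finset.range k, (-1 : ℝ) by simp, ← Finset.prod_mul_distrib]
    exact Finset.prod_congr rfl fun i _ => by ring
  rw [this]
  refine Finset.prod_pos fun i hi => sub_pos.2 (h2 _ (by omega) ?_)
  have := Finset.mem_range.1 hi
  omega

theorem exists_roots_of_alternating (p : ℝ[X]) {k : ℕ} {w : ℕ → ℝ}
    (hw : ∀ i < k, w i < w (i + 1)) (hs : ∀ i ≤ k, 0 < (-1) ^ (k - i) * p.eval (w i)) :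
    ∃ v : ℕ → ℝ, ∀ i < k, v i ∈ Ioo (w i) (w (i + 1)) ∧ p.eval (v i) = 0 := by
  have key : ∀ i, ∃ y, i < k → y ∈ Ioo (w i) (w (i + 1)) ∧ p.eval y = 0 := by
    intro i
    by_cases hi : i < k
    swap
    · exact ⟨0, fun h => absurd h hi⟩
    have h1 := hs i hi.le
    have h2 := hs (i + 1) hi
    rw [show k - i = (k - (i + 1)) + 1 by omega, pow_succ] at h1
    rcases neg_one_pow_eq_or ℝ (k - (i + 1)) with h | h <;> rw [h] at h1 h2
    · obtain ⟨y, hy, hy0⟩ := intermediate_value_Ioo (hw i hi).le (f := fun x => p.eval x)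
        p.continuous.continuousOn (show (0 : ℝ) ∈ _ from ⟨by linarith, by linarith⟩)
      exact ⟨y, fun _ => ⟨hy, hy0⟩⟩
    · obtain ⟨y, hy, hy0⟩ := intermediate_value_Ioo' (hw i hi).le (f := fun x => p.eval x)
        p.continuous.continuousOn (show (0 : ℝ) ∈ _ from ⟨by linarith, by linarith⟩)
      exact ⟨y, fun _ => ⟨hy, hy0⟩⟩
  choose v hv using key
  exact ⟨v, hv⟩

theorem lt_of_forall_lt_succ {u : ℕ → ℝ} {m : ℕ} (h : ∀ i, i + 1 < m → u i < u (i + 1)) {i j : ℕ}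
    (hij : i < j) (hj : j < m) : u i < u j := by
  induction j, hij using Nat.le_induction with
  | base => exact h i hj
  | succ j hij ih => exact (ih (by omega)).trans (h j hj)

theorem coeff_gegenbauer_pos (hα : -1 / 2 < α) (m : ℕ) : 0 < (gegenbauer α m).coeff m := by
  rcases m with _ | m
  · simp [gegenbauer]
  · rw [coeff_gegenbauer_succ]
    exact gegenbauerLead_pos hα m

theorem gegenbauer_eval_neg_one (hα : -1 / 2 < α) (m : ℕ) :
    (gegenbauer α m).eval (-1) = (-1) ^ m := by
  rw [gegenbauer_eval_neg hα, gegenbauer_eval_one hα, mul_one]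

/-- The zeros of `G_m` are real, simple and lie in `(-1, 1)`, and the signs of `G_{m+1}` alternate
on them. -/
theorem exists_gegenbauer_roots (hα : -1 / 2 < α) (m : ℕ) :
    ∃ u : ℕ → ℝ, (∀ i < m, u i ∈ Ioo (-1 : ℝ) 1 ∧ (gegenbauer α m).eval (u i) = 0) ∧
      (∀ i, i + 1 < m → u i < u (i + 1)) ∧
      ∀ i < m, 0 < (-1) ^ (m - i) * (gegenbauer α (m + 1)).eval (u i) := by
  induction m with
  | zero => exact ⟨0, by simp, by simp, by simp⟩
  | succ m ih =>
    obtain ⟨u, hu, hmono, hsign⟩ := ih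
    -- The mesh -1, u_0, …, u_{m-1}, 1, on which G_{m+1} alternates in sign; its zeros interlace
    -- with it.
    let w : ℕ → ℝ := fun j => if j = 0 then -1 else if j ≤ m then u (j - 1) else 1
    have w0 : w 0 = -1 := by simp [w]
    have w1 : ∀ i < m, w (i + 1) = u i := fun i hi => by
      simp [w, Nat.succ_le_of_lt hi]
    have w2 : w (m + 1) = 1 := by simp [w]
    have hw : ∀ i < m + 1, w i < w (i + 1) := by
      intro i hi
      rcases Nat.lt_succ_iff_lt_or_eq.1 hi with hi | rfl
      · rw [w1 i hi]
        rcases i with _ | i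
        · rw [w0]
          exact (hu 0 hi).1.1
        · rw [w1 i (by omega)]
          exact hmono i hi
      · rw [w2]
        rcases i with _ | i
        · rw [w0]
          norm_num
        · rw [w1 i (by omega)]
          exact (hu i (by omega)).1.2
    have hs : ∀ i ≤ m + 1, 0 < (-1) ^ (m + 1 - i) * (gegenbauer α (m + 1)).eval (w i) := by
      intro i hi
      rcases i with _ | i
      · rw [w0, gegenbauer_eval_neg_one hα, Nat.sub_zero, ← pow_add, Even.neg_one_pow ⟨_, rfl⟩]
        exact one_pos
      · rcases Nat.lt_succ_iff_lt_or_eq.1 (Nat.lt_of_succ_le hi) with hi | rfl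
        · rw [w1 i hi, Nat.add_sub_add_right]
          exact hsign i hi
        · rw [w2, gegenbauer_eval_one hα]
          simp
    obtain ⟨v, hv⟩ := exists_roots_of_alternating _ hw hs
    have wlow : ∀ i ≤ m + 1, -1 ≤ w i := by
      intro i hi
      rcases i with _ | i
      · exact w0.ge
      · rcases Nat.lt_succ_iff_lt_or_eq.1 (Nat.lt_of_succ_le hi) with hi | rfl
        · rw [w1 i hi]
          exact (hu i hi).1.1.le
        · rw [w2]
          norm_num
    have wup : ∀ i ≤ m + 1, w i ≤ 1 := by
      intro i hi
      rcases i with _ | i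
      · rw [w0]
        norm_num
      · rcases Nat.lt_succ_iff_lt_or_eq.1 (Nat.lt_of_succ_le hi) with hi | rfl
        · rw [w1 i hi]
          exact (hu i hi).1.2.le
        · exact w2.le
    refine ⟨v, fun i hi => ⟨⟨(wlow i hi.le).trans_lt (hv i hi).1.1,
      (hv i hi).1.2.trans_le (wup (i + 1) hi)⟩, (hv i hi).2⟩,
      fun i hi => (hv i (by omega)).1.2.trans (hv (i + 1) hi).1.1, fun i hi => ?_⟩
    have hinj : Set.InjOn u (Finset.range m) := by
      intro a ha b hb hab
      have ha := Finset.mem_range.1 ha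
      have hb := Finset.mem_range.1 hb
      rcases lt_trichotomy a b with h | h | h
      · exact absurd hab (lt_of_forall_lt_succ hmono h hb).ne
      · exact h
      · exact absurd hab (lt_of_forall_lt_succ hmono h ha).ne'
    have hfac := eq_C_mul_nodal (Finset.range m) u hinj (gegenbauer α m)
      ((natDegree_gegenbauer_le m).trans_eq (Finset.card_range m).symm)
      fun i hi => (hu i (Finset.mem_range.1 hi)).2
    have hprod : 0 < (-1) ^ (m - i) * ∏ l ∈ Finset.range m, (v i - u l) := by
      refine neg_one_pow_mul_prod_pos (by omega) (fun l hl => ?_) fun l hl hlm => ?_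
      · rcases i with _ | i
        · omega
        have h := (hv (i + 1) hi).1.1
        rw [w1 i (by omega)] at h
        rcases (Nat.lt_succ_iff_lt_or_eq.1 hl) with hl | rfl
        · exact (lt_of_forall_lt_succ hmono hl (by omega)).trans h
        · exact h
      · have h := (hv i hi).1.2
        rw [w1 i (by omega)] at h
        rcases hl.eq_or_lt with rfl | hl
        · exact h
        · exact h.trans (lt_of_forall_lt_succ hmono hl hlm)
    have hG : 0 < (-1) ^ (m - i) * (gegenbauer α m).eval (v i) := by
      rw [hfac, eval_mul, eval_C, Lagrange.eval_nodal, mul_left_comm, Finset.card_range]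
      exact mul_pos (coeff_gegenbauer_pos hα m) hprod
    have r := gegenbauer_recurrence hα m (v i)
    rw [(hv i hi).2] at r
    have hm1 : (0 : ℝ) < (m : ℝ) + 1 + 2 * α := by
      have := Nat.cast_nonneg (α := ℝ) m
      linarith
    -- At a zero of G_{m+1} the recurrence makes G_{m+2} opposite in sign to G_m, whose sign is read
    -- off its factorization over the interlacing zeros. This propagates the alternation.
    have r' : (gegenbauer α (m + 2)).eval (v i) =
        -(((m : ℝ) + 1) / (m + 1 + 2 * α)) * (gegenbauer α m).eval (v i) := by
      field_simp
      linarith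
    rw [r', show m + 1 - i = (m - i) + 1 by omega, pow_succ]
    have : 0 < ((m : ℝ) + 1) / (m + 1 + 2 * α) * ((-1) ^ (m - i) * (gegenbauer α m).eval (v i)) :=
      mul_pos (by positivity) hG
    linarith

theorem natDegree_radauPoly_le (n : ℕ) : (radauPoly α n).natDegree ≤ n + 1 :=
  (natDegree_sub_le _ _).trans (max_le (natDegree_gegenbauer_le _)
    ((natDegree_gegenbauer_le n).trans n.le_succ))

theorem coeff_radauPoly (n : ℕ) : (radauPoly α n).coeff (n + 1) = gegenbauerLead α n := by
  rw [radauPoly, coeff_sub, coeff_gegenbauer_succ,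
    coeff_eq_zero_of_natDegree_lt ((natDegree_gegenbauer_le n).trans_lt n.lt_succ_self), sub_zero]

/-- At the zeros of G_n the value of q_n is that of G_{n+1}, so q_n alternates on -1, u_0, …,
u_{n-1}. That gives n zeros below 1; with the zero at 1 the degree is exhausted, hence all roots are
simple. -/
theorem exists_radauPoly_roots (hα : -1 / 2 < α) (n : ℕ) :
    ∃ s : Finset ℝ, s.card = n + 1 ∧ (∀ x ∈ s, x ∈ Ioc (-1 : ℝ) 1) ∧ 1 ∈ s ∧
      (radauPoly α n).roots = s.val := by
  obtain ⟨u, hu, hmono, hsign⟩ := exists_gegenbauer_roots hα n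
  let w : ℕ → ℝ := fun j => if j = 0 then -1 else u (j - 1)
  have w0 : w 0 = -1 := by simp [w]
  have w1 : ∀ i, w (i + 1) = u i := fun i => by simp [w]
  have hw : ∀ i < n, w i < w (i + 1) := by
    intro i hi
    rw [w1]
    rcases i with _ | i
    · rw [w0]
      exact (hu 0 hi).1.1
    · rw [w1]
      exact hmono i hi
  have hs : ∀ i ≤ n, 0 < (-1) ^ (n - i) * (-radauPoly α n).eval (w i) := by
    intro i hi
    rcases i with _ | i
    · rw [w0, radauPoly, eval_neg, eval_sub, gegenbauer_eval_neg_one hα,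
        gegenbauer_eval_neg_one hα, Nat.sub_zero, pow_succ]
      rcases neg_one_pow_eq_or ℝ n with h | h <;> rw [h] <;> norm_num
    · have h := hsign i (by omega)
      rw [show n - i = (n - (i + 1)) + 1 by omega, pow_succ] at h
      rw [w1, radauPoly, eval_neg, eval_sub, (hu i (by omega)).2]
      linarith
  obtain ⟨v, hv⟩ := exists_roots_of_alternating _ hw hs
  have hvmono : ∀ i, i + 1 < n → v i < v (i + 1) :=
    fun i hi => (hv i (by omega)).1.2.trans (hv (i + 1) hi).1.1
  have hv' : ∀ i < n, v i ∈ Ioo (-1 : ℝ) 1 := by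
    intro i hi
    obtain ⟨⟨h1, h2⟩, -⟩ := hv i hi
    rw [w1] at h2
    refine ⟨?_, h2.trans (hu i hi).1.2⟩
    rcases i with _ | i
    · rwa [w0] at h1
    · rw [w1] at h1
      exact (hu i (by omega)).1.1.trans h1
  have hinj : Set.InjOn v (Finset.range n) := by
    intro a ha b hb hab
    have ha := Finset.mem_range.1 ha
    have hb := Finset.mem_range.1 hb
    rcases lt_trichotomy a b with h | h | h
    · exact absurd hab (lt_of_forall_lt_succ hvmono h hb).ne
    · exact h
    · exact absurd hab (lt_of_forall_lt_succ hvmono h ha).ne'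
  have h1 : (1 : ℝ) ∉ (Finset.range n).image v := by
    intro h
    obtain ⟨i, hi, h⟩ := Finset.mem_image.1 h
    exact (hv' i (Finset.mem_range.1 hi)).2.ne h
  refine ⟨insert 1 ((Finset.range n).image v), ?_, ?_, Finset.mem_insert_self _ _, ?_⟩
  · rw [Finset.card_insert_of_notMem h1, Finset.card_image_of_injOn hinj, Finset.card_range]
  · intro x hx
    rcases Finset.mem_insert.1 hx with rfl | hx
    · norm_num
    · obtain ⟨i, hi, rfl⟩ := Finset.mem_image.1 hx
      exact Ioo_subset_Ioc_self (hv' i (Finset.mem_range.1 hi))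
  · set s := insert 1 ((Finset.range n).image v) with hsdef
    have hcard : s.card = n + 1 := by
      rw [Finset.card_insert_of_notMem h1, Finset.card_image_of_injOn hinj, Finset.card_range]
    have hfac := eq_C_mul_nodal s id Function.injective_id.injOn (radauPoly α n)
      (by rw [hcard]; exact natDegree_radauPoly_le n) (by
        intro x hx
        rcases Finset.mem_insert.1 hx with rfl | hx
        · simp [radauPoly, gegenbauer_eval_one hα]
        · obtain ⟨i, hi, rfl⟩ := Finset.mem_image.1 hx
          have := (hv i (Finset.mem_range.1 hi)).2
          rwa [eval_neg, neg_eq_zero] at this)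
    rw [hcard, coeff_radauPoly, Lagrange.nodal] at hfac
    rw [hfac, roots_C_mul _ (gegenbauerLead_pos hα n).ne']
    exact roots_prod_X_sub_C s

theorem length_sort_roots_radauPoly (hα : -1 / 2 < α) (n : ℕ) :
    ((radauPoly α n).roots.sort (· ≥ ·)).length = n + 1 := by
  obtain ⟨s, hs, -, -, hr⟩ := exists_radauPoly_roots hα n
  rw [Multiset.length_sort, hr]
  exact hs

/-- The root list has exactly n + 1 entries, so the default value in `node` is never reached. -/
theorem node_eq_getElem (hα : -1 / 2 < α) (n : ℕ) (k : Fin (n + 1)) :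
    node α n k = ((radauPoly α n).roots.sort (· ≥ ·))[(k : ℕ)]'
      (by rw [length_sort_roots_radauPoly hα]; exact k.2) := by
  rw [node, List.getD_eq_getElem]

theorem node_mem_roots (hα : -1 / 2 < α) (n : ℕ) (k : Fin (n + 1)) :
    node α n k ∈ (radauPoly α n).roots := by
  rw [node_eq_getElem hα, ← Multiset.mem_sort (· ≥ ·)]
  exact List.getElem_mem _

theorem node_mem_Ioc (hα : -1 / 2 < α) (n : ℕ) (k : Fin (n + 1)) :
    node α n k ∈ Ioc (-1 : ℝ) 1 := by
  obtain ⟨s, -, h, -, hr⟩ := exists_radauPoly_roots hα n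
  have := node_mem_roots hα n k
  rw [hr] at this
  exact h _ this

theorem node_injective (hα : -1 / 2 < α) (n : ℕ) : Function.Injective (node α n) := by
  intro i j hij
  obtain ⟨s, -, -, -, hr⟩ := exists_radauPoly_roots hα n
  have hnd : ((radauPoly α n).roots.sort (· ≥ ·)).Nodup := by
    rw [← Multiset.coe_nodup, Multiset.sort_eq, hr]
    exact s.nodup
  rw [node_eq_getElem hα, node_eq_getElem hα] at hij
  exact Fin.ext ((hnd.getElem_inj_iff).1 hij)

theorem node_zero (hα : -1 / 2 < α) (n : ℕ) : node α n 0 = 1 := by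
  refine le_antisymm (node_mem_Ioc hα n 0).2 ?_
  obtain ⟨s, -, -, h1, hr⟩ := exists_radauPoly_roots hα n
  have hmem : (1 : ℝ) ∈ (radauPoly α n).roots.sort (· ≥ ·) := by
    rw [Multiset.mem_sort, hr]
    exact h1
  obtain ⟨j, hj, hj1⟩ := List.getElem_of_mem hmem
  rw [node_eq_getElem hα]
  have hsort := Multiset.pairwise_sort (radauPoly α n).roots (· ≥ ·)
  rcases Nat.eq_zero_or_pos j with rfl | hpos
  · exact hj1.ge
  · rw [← hj1]
    exact List.pairwise_iff_getElem.1 hsort 0 j _ hj hpos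

theorem radauPoly_eq_nodal (hα : -1 / 2 < α) (n : ℕ) :
    radauPoly α n = C (gegenbauerLead α n) * Lagrange.nodal Finset.univ (node α n) := by
  have h := eq_C_mul_nodal Finset.univ (node α n) (node_injective hα n).injOn (radauPoly α n)
    (by simpa using natDegree_radauPoly_le n)
    fun i _ => (mem_roots'.1 (node_mem_roots hα n i)).2
  rwa [Finset.card_univ, Fintype.card_fin, coeff_radauPoly] at h

end Nodes

/-! ### Lagrange interpolation on the half-open interval: Rolle, remainder, leading coefficient. -/

section Interpolation

/-- Rolle's theorem between consecutive zeros loses one zero per derivative. Derivatives are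
required only on the open interval, so one-sided behaviour at b is harmless. -/
theorem exists_eq_zero_of_card_lt {b : ℝ} (m : ℕ) (F : ℕ → ℝ → ℝ)
    (hc : ∀ k < m, ContinuousOn (F k) (Ioc 0 b))
    (hd : ∀ k < m, ∀ x ∈ Ioo 0 b, HasDerivAt (F k) (F (k + 1) x) x)
    (s : Finset ℝ) (hs : ∀ x ∈ s, x ∈ Ioc 0 b) (hcard : s.card = m + 1)
    (h0 : ∀ x ∈ s, F 0 x = 0) : ∃ ξ ∈ Ioc 0 b, F m ξ = 0 := by
  induction m generalizing F s with
  | zero =>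
    obtain ⟨x, hx⟩ := Finset.card_pos.1 (by omega : 0 < s.card)
    exact ⟨x, hs x hx, h0 x hx⟩
  | succ m ih =>
    let e := s.orderEmbOfFin hcard
    have he : ∀ i, e i ∈ s := fun i => s.orderEmbOfFin_mem hcard i
    have key : ∀ i : Fin (m + 1), ∃ c ∈ Ioo (e i.castSucc) (e i.succ), F 1 c = 0 := by
      intro i
      have hlt : e i.castSucc < e i.succ := e.strictMono (Fin.castSucc_lt_succ)
      have hsub : Icc (e i.castSucc) (e i.succ) ⊆ Ioc 0 b := fun x hx =>
        ⟨(hs _ (he i.castSucc)).1.trans_le hx.1, hx.2.trans (hs _ (he i.succ)).2⟩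
      refine exists_hasDerivAt_eq_zero hlt ((hc 0 m.succ_pos).mono hsub)
        (by rw [h0 _ (he _), h0 _ (he _)]) fun x hx => hd 0 m.succ_pos x ?_
      exact ⟨(hs _ (he i.castSucc)).1.trans hx.1, hx.2.trans_le (hs _ (he i.succ)).2⟩
    choose v hv hv0 using key
    have hmono : StrictMono v := by
      intro i j hij
      have : e i.succ ≤ e j.castSucc := e.monotone (Fin.le_def.2 (by simpa using hij))
      exact (hv i).2.trans (this.trans_lt (hv j).1)
    refine ih (fun k => F (k + 1)) (fun k hk => hc _ (by omega)) (fun k hk => hd _ (by omega))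
      (Finset.univ.image v) ?_ ?_ ?_
    · intro x hx
      obtain ⟨i, -, rfl⟩ := Finset.mem_image.1 hx
      exact ⟨(hs _ (he i.castSucc)).1.trans (hv i).1,
        (hv i).2.le.trans (hs _ (he i.succ)).2⟩
    · rw [Finset.card_image_of_injective _ hmono.injective, Finset.card_univ, Fintype.card_fin]
    · intro x hx
      obtain ⟨i, -, rfl⟩ := Finset.mem_image.1 hx
      exact hv0 i

theorem exists_eq_factorial_mul_coeff {b : ℝ} (m : ℕ) (D : ℕ → ℝ → ℝ)
    (hc : ∀ k < m, ContinuousOn (D k) (Ioc 0 b))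
    (hd : ∀ k < m, ∀ x ∈ Ioo 0 b, HasDerivAt (D k) (D (k + 1) x) x)
    (s : Finset ℝ) (hs : ∀ x ∈ s, x ∈ Ioc 0 b) (hcard : s.card = m + 1)
    (p : ℝ[X]) (hp : p.natDegree ≤ m) (h0 : ∀ x ∈ s, D 0 x = p.eval x) :
    ∃ ξ ∈ Ioc 0 b, D m ξ = m.factorial * p.coeff m := by
  obtain ⟨ξ, hξ, h⟩ := exists_eq_zero_of_card_lt m
    (fun k x => D k x - (derivative^[k] p).eval x)
    (fun k hk => (hc k hk).sub (Polynomial.continuous _).continuousOn)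
    (fun k hk x hx => by
      rw [Function.iterate_succ_apply']
      exact (hd k hk x hx).sub (Polynomial.hasDerivAt _ x)) s hs hcard
    (fun x hx => by simp [h0 x hx])
  refine ⟨ξ, hξ, ?_⟩
  have hdeg : (derivative^[m] p).natDegree ≤ 0 :=
    (natDegree_iterate_derivative p m).trans (by omega)
  have hco : (derivative^[m] p).coeff 0 = m.factorial * p.coeff m := by
    rw [coeff_iterate_derivative, zero_add, Nat.descFactorial_self, nsmul_eq_mul]
  rw [eq_C_of_natDegree_le_zero hdeg, eval_C, hco] at h
  linarith

variable {b A : ℝ} {n : ℕ} {D : ℕ → ℝ → ℝ} {v : Fin (n + 1) → ℝ}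

theorem natDegree_interpolate_le (hv : Function.Injective v) (r : Fin (n + 1) → ℝ) :
    (Lagrange.interpolate Finset.univ v r).natDegree ≤ n := by
  have := Lagrange.degree_interpolate_le (s := Finset.univ) r hv.injOn
  rw [Finset.card_univ, Fintype.card_fin, Nat.add_sub_cancel] at this
  exact natDegree_le_of_degree_le this

/-- The coefficient is the divided difference of order n, hence an n-th derivative value over n!. -/
theorem abs_coeff_interpolate_le (hv : Function.Injective v) (hvb : ∀ i, v i ∈ Ioc 0 b)
    (hc : ∀ k < n, ContinuousOn (D k) (Ioc 0 b))
    (hd : ∀ k < n, ∀ x ∈ Ioo 0 b, HasDerivAt (D k) (D (k + 1) x) x)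
    (hA : ∀ x ∈ Ioc 0 b, |D n x| ≤ A) :
    |(Lagrange.interpolate Finset.univ v (fun i => D 0 (v i))).coeff n| ≤ A / n.factorial := by
  obtain ⟨ξ, hξ, h⟩ := exists_eq_factorial_mul_coeff n D hc hd (Finset.univ.image v)
    (fun x hx => by
      obtain ⟨i, -, rfl⟩ := Finset.mem_image.1 hx
      exact hvb i)
    (by rw [Finset.card_image_of_injective _ hv, Finset.card_univ, Fintype.card_fin]) _
    (natDegree_interpolate_le hv (fun i => D 0 (v i))) (fun x hx => by
      obtain ⟨i, -, rfl⟩ := Finset.mem_image.1 hx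
      rw [Lagrange.eval_interpolate_at_node _ hv.injOn (Finset.mem_univ i)])
  have h1 := hA ξ hξ
  rw [h, abs_mul, Nat.abs_cast] at h1
  rw [le_div_iff₀ (by positivity)]
  linarith

theorem abs_sub_interpolate_le (hv : Function.Injective v) (hvb : ∀ i, v i ∈ Ioc 0 b)
    (hc : ∀ k < n + 1, ContinuousOn (D k) (Ioc 0 b))
    (hd : ∀ k < n + 1, ∀ x ∈ Ioo 0 b, HasDerivAt (D k) (D (k + 1) x) x)
    (hA : ∀ x ∈ Ioc 0 b, |D (n + 1) x| ≤ A) {x : ℝ} (hx : x ∈ Ioc 0 b) :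
    |D 0 x - (Lagrange.interpolate Finset.univ v (fun i => D 0 (v i))).eval x| ≤
      A / (n + 1).factorial * |(Lagrange.nodal Finset.univ v).eval x| := by
  have hA0 : 0 ≤ A := (abs_nonneg _).trans (hA x hx)
  by_cases hxv : x ∈ Finset.univ.image v
  · obtain ⟨i, -, rfl⟩ := Finset.mem_image.1 hxv
    rw [Lagrange.eval_interpolate_at_node _ hv.injOn (Finset.mem_univ i), sub_self, abs_zero]
    positivity
  have hne : (Lagrange.nodal Finset.univ v).eval x ≠ 0 := by
    rw [Lagrange.eval_nodal, Finset.prod_ne_zero_iff]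
    intro i _ h
    exact hxv (Finset.mem_image.2 ⟨i, Finset.mem_univ i, (sub_eq_zero.1 h).symm⟩)
  set p := Lagrange.interpolate Finset.univ v (fun i => D 0 (v i)) with hp
  -- Chosen so that p + κ · nodal also interpolates at x; κ is then the leading coefficient on n + 2
  -- points and is bounded by Rolle.
  set κ := (D 0 x - p.eval x) / (Lagrange.nodal Finset.univ v).eval x with hκ
  have hnat : (Lagrange.nodal Finset.univ v).natDegree = n + 1 := by
    rw [Lagrange.natDegree_nodal, Finset.card_univ, Fintype.card_fin]
  have hpn := natDegree_interpolate_le hv (fun i => D 0 (v i))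
  obtain ⟨ξ, hξ, h⟩ := exists_eq_factorial_mul_coeff (n + 1) D hc hd
    (insert x (Finset.univ.image v))
    (fun z hz => by
      rcases Finset.mem_insert.1 hz with rfl | hz
      · exact hx
      · obtain ⟨i, -, rfl⟩ := Finset.mem_image.1 hz
        exact hvb i)
    (by rw [Finset.card_insert_of_notMem hxv, Finset.card_image_of_injective _ hv,
      Finset.card_univ, Fintype.card_fin])
    (p + C κ * Lagrange.nodal Finset.univ v)
    ((natDegree_add_le _ _).trans (max_le (hpn.trans n.le_succ)
      ((natDegree_C_mul_le _ _).trans hnat.le)))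
    (fun z hz => by
      rcases Finset.mem_insert.1 hz with rfl | hz
      · rw [eval_add, eval_mul, eval_C, hκ, div_mul_cancel₀ _ hne]
        ring
      · obtain ⟨i, -, rfl⟩ := Finset.mem_image.1 hz
        rw [eval_add, eval_mul, Lagrange.eval_nodal_at_node (Finset.mem_univ i), hp,
          Lagrange.eval_interpolate_at_node _ hv.injOn (Finset.mem_univ i), mul_zero, add_zero])
  have hco : (p + C κ * Lagrange.nodal Finset.univ v).coeff (n + 1) = κ := by
    have h1 : (Lagrange.nodal Finset.univ v).coeff (n + 1) = 1 := by
      have := (Lagrange.nodal_monic (s := Finset.univ) (v := v)).coeff_natDegree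
      rwa [hnat] at this
    rw [coeff_add, coeff_C_mul, h1, coeff_eq_zero_of_natDegree_lt (hpn.trans_lt n.lt_succ_self),
      mul_one, zero_add]
  rw [hco] at h
  have h1 := hA ξ hξ
  rw [h, abs_mul, Nat.abs_cast] at h1
  have h2 : D 0 x - p.eval x = κ * (Lagrange.nodal Finset.univ v).eval x := by
    rw [hκ, div_mul_cancel₀ _ hne]
  rw [h2, abs_mul]
  refine mul_le_mul_of_nonneg_right ?_ (abs_nonneg _)
  rw [le_div_iff₀ (by positivity)]
  linarith

/-- Multiplying the data by `c - x` multiplies the interpolant by `c - X`, up to a multiple of the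
nodal polynomial. -/
theorem interpolate_sub_mul (hv : Function.Injective v) (r : Fin (n + 1) → ℝ) (c : ℝ) :
    Lagrange.interpolate Finset.univ v (fun k => (c - v k) * r k) =
      (C c - X) * Lagrange.interpolate Finset.univ v r
        + C ((Lagrange.interpolate Finset.univ v r).coeff n) * Lagrange.nodal Finset.univ v := by
  set p := Lagrange.interpolate Finset.univ v r with hp
  symm
  have hnat : (Lagrange.nodal Finset.univ v).natDegree = n + 1 := by
    rw [Lagrange.natDegree_nodal, Finset.card_univ, Fintype.card_fin]
  have hpn : p.natDegree ≤ n := natDegree_interpolate_le hv r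
  refine Lagrange.eq_interpolate_of_eval_eq _ hv.injOn ?_ fun i hi => ?_
  · rw [Finset.card_univ, Fintype.card_fin, degree_lt_iff_coeff_zero]
    intro m hm
    rw [sub_mul, coeff_add, coeff_sub, coeff_C_mul, coeff_C_mul,
      coeff_eq_zero_of_natDegree_lt (hpn.trans_lt (by omega : n < m))]
    rcases hm.eq_or_lt with rfl | hm
    · have h1 : (Lagrange.nodal Finset.univ v).coeff (n + 1) = 1 := by
        have := (Lagrange.nodal_monic (s := Finset.univ) (v := v)).coeff_natDegree
        rwa [hnat] at this
      rw [coeff_X_mul, h1]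
      ring
    · obtain ⟨l, rfl⟩ : ∃ l, m = l + 1 := ⟨m - 1, by omega⟩
      rw [coeff_X_mul, coeff_eq_zero_of_natDegree_lt (hpn.trans_lt (by omega : n < l)),
        coeff_eq_zero_of_natDegree_lt (hnat.trans_lt (by omega : n + 1 < l + 1))]
      ring
  · rw [eval_add, eval_mul, eval_mul, Lagrange.eval_nodal_at_node hi, hp,
      Lagrange.eval_interpolate_at_node _ hv.injOn hi, eval_sub, eval_C, eval_X, mul_zero, add_zero]

end Interpolation

/-! ### Behaviour of the solution near 0 and integral representations of y' and y. -/

section Derivatives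

variable {b : ℝ} {y : ℝ → ℝ} {N : ℕ}

theorem der_zero : der b 0 y = y := iteratedDerivWithin_zero

theorem continuousOn_der (hy : ContDiffOn ℝ (N : WithTop ℕ∞) y (Ioc 0 b)) {k : ℕ}
    (hk : k ≤ N) : ContinuousOn (der b k y) (Ioc 0 b) :=
  hy.continuousOn_iteratedDerivWithin (by exact_mod_cast hk) (uniqueDiffOn_Ioc 0 b)

theorem hasDerivWithinAt_der (hy : ContDiffOn ℝ (N : WithTop ℕ∞) y (Ioc 0 b)) {k : ℕ}
    (hk : k < N) {x : ℝ} (hx : x ∈ Ioc 0 b) :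
    HasDerivWithinAt (der b k y) (der b (k + 1) y x) (Ioc 0 b) x := by
  have h := (hy.differentiableOn_iteratedDerivWithin (m := k) (by exact_mod_cast hk)
    (uniqueDiffOn_Ioc 0 b)) x hx
  have := h.hasDerivWithinAt
  rwa [← iteratedDerivWithin_succ] at this

theorem hasDerivAt_der (hy : ContDiffOn ℝ (N : WithTop ℕ∞) y (Ioc 0 b)) {k : ℕ}
    (hk : k < N) {x : ℝ} (hx : x ∈ Ioo 0 b) : HasDerivAt (der b k y) (der b (k + 1) y x) x :=
  (hasDerivWithinAt_der hy hk (Ioo_subset_Ioc_self hx)).hasDerivAt (Ioc_mem_nhds hx.1 hx.2)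

/-- Smoothness on (0, b] says nothing at 0. On a bounded interval the mean value inequality passes a
bound down from the top derivative, which makes y'' integrable. -/
theorem exists_abs_der_le (hb : 0 < b) (hy : ContDiffOn ℝ (N : WithTop ℕ∞) y (Ioc 0 b)) {A : ℝ}
    (hA : ∀ x ∈ Ioc 0 b, |der b N y x| ≤ A) {k : ℕ} (hk : k ≤ N) :
    ∃ B, ∀ x ∈ Ioc 0 b, |der b k y x| ≤ B := by
  induction hk using Nat.decreasingInduction with
  | self => exact ⟨A, hA⟩
  | of_succ k hk ih =>
    obtain ⟨B, hB⟩ := ih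
    refine ⟨|der b k y b| + B * b, fun x hx => ?_⟩
    have hbm : b ∈ Ioc 0 b := ⟨hb, le_rfl⟩
    have h := (convex_Ioc 0 b).norm_image_sub_le_of_norm_hasDerivWithin_le
      (fun z hz => hasDerivWithinAt_der hy hk hz) hB hbm hx
    have hB0 : 0 ≤ B := (abs_nonneg _).trans (hB x hx)
    have h1 : ‖x - b‖ ≤ b := by
      rw [Real.norm_eq_abs, abs_le]
      constructor <;> linarith [hx.1, hx.2]
    have h2 : |der b k y x - der b k y b| ≤ B * b := h.trans (mul_le_mul_of_nonneg_left h1 hB0)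
    have := abs_sub_abs_le_abs_sub (der b k y x) (der b k y b)
    linarith

/-- The slope from 0 to x equals y' at some c in (0, x), and y'(x) differs from y'(c) by at most Bx.
Thus the one-sided derivative at 0 is the limit of y'. -/
theorem tendsto_der_one (hb : 0 < b) (hy : ContDiffOn ℝ (2 : ℕ) y (Ioc 0 b)) {B a : ℝ}
    (hB : ∀ x ∈ Ioc 0 b, |der b 2 y x| ≤ B) (h0 : HasDerivWithinAt y a (Icc 0 b) 0) :
    Tendsto (der b 1 y) (nhdsWithin 0 (Ioi 0)) (nhds a) := by
  have hy0 : ContinuousOn y (Icc 0 b) := by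
    intro x hx
    rcases hx.1.eq_or_lt with rfl | hx0
    · exact h0.continuousWithinAt
    · have := (hy.continuousOn x ⟨hx0, hx.2⟩)
      refine this.mono_of_mem_nhdsWithin ?_
      have : Ioc 0 b = Icc 0 b ∩ Ioi 0 := by
        ext z
        simp only [mem_Ioc, mem_inter_iff, mem_Icc, mem_Ioi]
        constructor
        · exact fun h => ⟨⟨h.1.le, h.2⟩, h.1⟩
        · exact fun h => ⟨h.2, h.1.2⟩
      rw [this]
      exact inter_mem self_mem_nhdsWithin (mem_nhdsWithin_of_mem_nhds (Ioi_mem_nhds hx0))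
  have hB0 : 0 ≤ B := (abs_nonneg _).trans (hB b ⟨hb, le_rfl⟩)
  have hslope : Tendsto (fun x => (y x - y 0) / x) (nhdsWithin 0 (Ioi 0)) (nhds a) := by
    have h := hasDerivWithinAt_iff_tendsto_slope.1 h0
    have hset : Icc 0 b \ {0} = Ioc 0 b := Icc_sdiff_left
    rw [hset, nhdsWithin_Ioc_eq_nhdsGT hb] at h
    refine h.congr fun x => ?_
    rw [slope_def_field, sub_zero]
  have hdiff : Tendsto (fun x => der b 1 y x - (y x - y 0) / x) (nhdsWithin 0 (Ioi 0))
      (nhds 0) := by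
    have hlim : Tendsto (fun x : ℝ => B * x) (nhdsWithin 0 (Ioi 0)) (nhds 0) := by
      have : Tendsto (fun x : ℝ => B * x) (nhds 0) (nhds (B * 0)) :=
        (continuous_const.mul continuous_id).tendsto 0
      rw [mul_zero] at this
      exact this.mono_left nhdsWithin_le_nhds
    refine squeeze_zero_norm' ?_ hlim
    filter_upwards [Ioc_mem_nhdsGT hb] with x hx
    obtain ⟨c, hc, hcd⟩ := exists_hasDerivAt_eq_slope y (der b 1 y) hx.1
      (hy0.mono (Icc_subset_Icc_right hx.2)) (fun z hz => by
        have := hasDerivAt_der (k := 0) hy (by norm_num) ⟨hz.1, hz.2.trans_le hx.2⟩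
        rwa [der_zero] at this)
    rw [sub_zero] at hcd
    rw [← hcd]
    have h := (convex_Ioc 0 b).norm_image_sub_le_of_norm_hasDerivWithin_le
      (fun z hz => hasDerivWithinAt_der (k := 1) hy (by norm_num) hz) hB
      ⟨hc.1, hc.2.le.trans hx.2⟩ hx
    refine h.trans (mul_le_mul_of_nonneg_left ?_ hB0)
    rw [Real.norm_eq_abs, abs_le]
    constructor <;> linarith [hc.1, hc.2]
  have := hdiff.add hslope
  simpa using this

theorem tendsto_nhdsGT_zero (hb : 0 < b) {a : ℝ}
    (h0 : HasDerivWithinAt y a (Icc 0 b) 0) :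
    Tendsto y (nhdsWithin 0 (Ioi 0)) (nhds (y 0)) := by
  have := h0.continuousWithinAt.mono (Ioc_subset_Icc_self)
  rwa [ContinuousWithinAt, nhdsWithin_Ioc_eq_nhdsGT hb] at this

theorem intervalIntegrable_of_bounded {f : ℝ → ℝ} {x B : ℝ} (hx : x ∈ Ioc 0 b)
    (hf : ContinuousOn f (Ioc 0 b)) (hB : ∀ x ∈ Ioc 0 b, |f x| ≤ B) :
    IntervalIntegrable f volume 0 x := by
  rw [intervalIntegrable_iff_integrableOn_Ioc_of_le hx.1.le]
  have hsub : Ioc 0 x ⊆ Ioc 0 b := Ioc_subset_Ioc_right hx.2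
  refine Integrable.mono' (g := fun _ => B) (by simp)
    ((hf.mono hsub).aestronglyMeasurable measurableSet_Ioc) ?_
  exact (ae_restrict_iff' measurableSet_Ioc).2 (Eventually.of_forall fun z hz => hB z (hsub hz))

theorem integral_der_two (hb : 0 < b) (hy : ContDiffOn ℝ (2 : ℕ) y (Ioc 0 b)) {B a : ℝ}
    (hB : ∀ x ∈ Ioc 0 b, |der b 2 y x| ≤ B) (h0 : HasDerivWithinAt y a (Icc 0 b) 0) {x : ℝ}
    (hx : x ∈ Ioc 0 b) : ∫ s in 0..x, der b 2 y s = der b 1 y x - a := by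
  refine intervalIntegral.integral_eq_sub_of_hasDerivAt_of_tendsto hx.1
    (fun z hz => hasDerivAt_der (k := 1) hy (by norm_num) ⟨hz.1, hz.2.trans_le hx.2⟩)
    (intervalIntegrable_of_bounded hx (continuousOn_der hy le_rfl) hB)
    (tendsto_der_one hb hy hB h0) ?_
  have := (continuousOn_der (k := 1) hy (by norm_num)) x hx
  exact (this.mono (fun z hz => ⟨hz.1, hz.2.le.trans hx.2⟩ : Ioo 0 x ⊆ Ioc 0 b)).tendsto.mono_left
    (by rw [nhdsWithin_Ioo_eq_nhdsLT hx.1])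

/-- The integrand has antiderivative (x - s) y'(s) + y(s), which has one-sided limits at both ends.
-/
theorem integral_sub_mul_der_two (hb : 0 < b) (hy : ContDiffOn ℝ (2 : ℕ) y (Ioc 0 b)) {B a : ℝ}
    (hB : ∀ x ∈ Ioc 0 b, |der b 2 y x| ≤ B) (h0 : HasDerivWithinAt y a (Icc 0 b) 0) {x : ℝ}
    (hx : x ∈ Ioc 0 b) : ∫ s in 0..x, (x - s) * der b 2 y s = y x - y 0 - a * x := by
  have hder : ∀ z ∈ Ioo 0 x, HasDerivAt (fun s => (x - s) * der b 1 y s + y s)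
      ((x - z) * der b 2 y z) z := by
    intro z hz
    have hz' : z ∈ Ioo 0 b := ⟨hz.1, hz.2.trans_le hx.2⟩
    have h1 := hasDerivAt_der (k := 1) hy (by norm_num) hz'
    have h2 := hasDerivAt_der (k := 0) hy (by norm_num) hz'
    rw [der_zero] at h2
    have h3 := (((hasDerivAt_id z).const_sub x).mul h1).add h2
    refine h3.congr_deriv ?_
    change -1 * der b 1 y z + (x - z) * der b 2 y z + der b 1 y z = _
    ring
  have hcont : ContinuousOn (fun s => (x - s) * der b 2 y s) (Ioc 0 b) :=
    (continuousOn_const.sub continuousOn_id).mul (continuousOn_der hy le_rfl)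
  have hbd : ∀ s ∈ Ioc 0 b, |(x - s) * der b 2 y s| ≤ b * B := by
    intro s hs
    rw [abs_mul]
    refine mul_le_mul ?_ (hB s hs) (abs_nonneg _) hb.le
    rw [abs_le]
    constructor <;> linarith [hs.1, hs.2, hx.1, hx.2]
  have hl : Tendsto (fun s => (x - s) * der b 1 y s + y s) (nhdsWithin 0 (Ioi 0))
      (nhds ((x - 0) * a + y 0)) := by
    refine Tendsto.add (Tendsto.mul ?_ (tendsto_der_one hb hy hB h0)) (tendsto_nhdsGT_zero hb h0)
    exact ((continuous_const.sub continuous_id).tendsto 0).mono_left nhdsWithin_le_nhds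
  have hr : Tendsto (fun s => (x - s) * der b 1 y s + y s) (nhdsWithin x (Iio x))
      (nhds ((x - x) * der b 1 y x + y x)) := by
    have hc : ContinuousOn (fun s => (x - s) * der b 1 y s + y s) (Ioc 0 b) :=
      ((continuousOn_const.sub continuousOn_id).mul
        (continuousOn_der (k := 1) hy (by norm_num))).add hy.continuousOn
    exact ((hc x hx).mono (fun z hz => ⟨hz.1, hz.2.le.trans hx.2⟩ :
      Ioo 0 x ⊆ Ioc 0 b)).tendsto.mono_left (by rw [nhdsWithin_Ioo_eq_nhdsLT hx.1])
  rw [intervalIntegral.integral_eq_sub_of_hasDerivAt_of_tendsto hx.1 hder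
    (intervalIntegrable_of_bounded hx hcont hbd) hl hr]
  ring

end Derivatives

/-! ### The integration matrices as integrals of interpolants; the nodal polynomial as rescaled q_n.
-/

section Matrices

variable {α b : ℝ} {n : ℕ}

theorem snode_mem_Ioc (hα : -1 / 2 < α) (hb : 0 < b) (k : Fin (n + 1)) :
    snode b α n k ∈ Ioc 0 b := by
  obtain ⟨h1, h2⟩ := node_mem_Ioc hα n k
  rw [snode]
  constructor
  · have : 0 < node α n k + 1 := by linarith
    positivity
  · nlinarith

theorem snode_injective (hα : -1 / 2 < α) (hb : 0 < b) : Function.Injective (snode b α n) := by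
  intro i j h
  rw [snode, snode] at h
  have := mul_left_cancel₀ (by positivity : b / 2 ≠ 0) h
  exact node_injective hα n (by linarith)

theorem snode_zero (hα : -1 / 2 < α) : snode b α n 0 = b := by
  rw [snode, node_zero hα]
  ring

theorem two_div_mul_snode_sub (hb : 0 < b) (k : Fin (n + 1)) :
    2 / b * snode b α n k - 1 = node α n k := by
  rw [snode]
  field_simp
  ring

theorem sub_snode (hb : 0 < b) (k : Fin (n + 1)) (x : ℝ) :
    x - snode b α n k = b / 2 * ((2 / b * x - 1) - node α n k) := by
  rw [snode]
  field_simp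
  ring

theorem eval_basis_snode (hb : 0 < b) (k : Fin (n + 1)) (x : ℝ) :
    (Lagrange.basis Finset.univ (snode b α n) k).eval x =
      (Lagrange.basis Finset.univ (node α n) k).eval (2 / b * x - 1) := by
  rw [Lagrange.basis, Lagrange.basis, eval_prod, eval_prod]
  refine Finset.prod_congr rfl fun j _ => ?_
  simp only [Lagrange.basisDivisor, eval_mul, eval_sub, eval_C, eval_X]
  rw [sub_snode hb j, sub_snode hb j, two_div_mul_snode_sub hb]
  have hb2 : b / 2 ≠ 0 := by positivity
  rw [mul_inv, mul_mul_mul_comm, inv_mul_cancel₀ hb2, one_mul]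

theorem integral_eval_comp (hb : 0 < b) (p : ℝ[X]) (k : Fin (n + 1)) :
    ∫ s in 0..snode b α n k, p.eval (2 / b * s - 1) =
      b / 2 * ∫ t in (-1 : ℝ)..node α n k, p.eval t := by
  rw [intervalIntegral.integral_comp_mul_sub (fun t => p.eval t) (by positivity : 2 / b ≠ 0) 1,
    two_div_mul_snode_sub hb, mul_zero, zero_sub, inv_div, smul_eq_mul]

theorem Qb1_apply (hb : 0 < b) (i k : Fin (n + 1)) :
    Qb1 b α n i k =
      ∫ s in 0..snode b α n i, (Lagrange.basis Finset.univ (snode b α n) k).eval s := by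
  simp only [eval_basis_snode hb, integral_eval_comp hb]
  rfl

theorem Qb1_mulVec (hb : 0 < b) (Φ : Fin (n + 1) → ℝ) (i : Fin (n + 1)) :
    (Qb1 b α n).mulVec Φ i =
      ∫ s in 0..snode b α n i, (Lagrange.interpolate Finset.univ (snode b α n) Φ).eval s := by
  simp only [Matrix.mulVec, dotProduct, Lagrange.interpolate_apply, eval_finsetSum, eval_mul,
    eval_C, Qb1_apply hb]
  rw [intervalIntegral.integral_finsetSum]
  · refine Finset.sum_congr rfl fun k _ => ?_
    rw [intervalIntegral.integral_const_mul, mul_comm]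
  · exact fun k _ => (continuous_const.mul (Polynomial.continuous _)).intervalIntegrable _ _

/-- Row i is the first-order matrix acting on the data (x_i - x_k) Φ_k. The second summand is the
price of interpolating this product in degree n; it is where A₀ enters the residual. -/
theorem Qb2_mulVec (hα : -1 / 2 < α) (hb : 0 < b) (Φ : Fin (n + 1) → ℝ) (i : Fin (n + 1)) :
    (Qb2 b α n).mulVec Φ i =
      (∫ s in 0..snode b α n i, (snode b α n i - s) *
        (Lagrange.interpolate Finset.univ (snode b α n) Φ).eval s)
      + (Lagrange.interpolate Finset.univ (snode b α n) Φ).coeff n *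
        ∫ s in 0..snode b α n i, (Lagrange.nodal Finset.univ (snode b α n)).eval s := by
  have h : (Qb2 b α n).mulVec Φ i =
      (Qb1 b α n).mulVec (fun k => (snode b α n i - snode b α n k) * Φ k) i := by
    simp only [Matrix.mulVec, dotProduct, Qb2, Matrix.of_apply]
    exact Finset.sum_congr rfl fun k _ => by ring
  rw [h, Qb1_mulVec hb, interpolate_sub_mul (snode_injective hα hb),
    ← intervalIntegral.integral_const_mul, ← intervalIntegral.integral_add]
  · simp only [eval_add, eval_mul, eval_sub, eval_C, eval_X]
  · exact ((continuous_const.sub continuous_id).mul (Polynomial.continuous _)).intervalIntegrable _ _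
  · exact (continuous_const.mul (Polynomial.continuous _)).intervalIntegrable _ _

theorem eval_nodal_snode (hα : -1 / 2 < α) (hb : 0 < b) (x : ℝ) :
    (Lagrange.nodal Finset.univ (snode b α n)).eval x =
      (b / 2) ^ (n + 1) / gegenbauerLead α n * (radauPoly α n).eval (2 / b * x - 1) := by
  have hK := (gegenbauerLead_pos hα n).ne'
  rw [radauPoly_eq_nodal hα, eval_mul, eval_C, ← mul_assoc, div_mul_cancel₀ _ hK,
    Lagrange.eval_nodal, Lagrange.eval_nodal, Finset.prod_congr rfl fun k _ => sub_snode hb k x,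
    Finset.prod_mul_distrib, Finset.prod_const, Finset.card_univ, Fintype.card_fin]

theorem integral_nodal_snode (hα : -1 / 2 < α) (hb : 0 < b) (k : Fin (n + 1)) :
    ∫ s in 0..snode b α n k, (Lagrange.nodal Finset.univ (snode b α n)).eval s =
      (b / 2) ^ (n + 2) / gegenbauerLead α n *
        ∫ t in (-1 : ℝ)..node α n k, (radauPoly α n).eval t := by
  simp only [eval_nodal_snode hα hb]
  rw [intervalIntegral.integral_const_mul, integral_eval_comp hb]
  ring

end Matrices

/-! ### The residual in terms of interpolation errors. -/

section Residual

variable {α : ℝ} {n : ℕ} {P : Problem}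

theorem residual_eq_zero_of_system {Φ : Fin (n + 1) → ℝ}
    (h : (P.sysMat α n).mulVec Φ = P.sysRhs α n) (i : Fin (n + 1)) : P.residual α Φ i = 0 := by
  have hi := congrFun h i
  rw [Problem.sysMat, Problem.H, Matrix.add_mulVec, Matrix.add_mulVec, Matrix.one_mulVec,
    Matrix.smul_mulVec, ← Matrix.mulVec_mulVec, ← Matrix.mulVec_mulVec] at hi
  simp only [Pi.add_apply, Pi.smul_apply, Matrix.mulVec_diagonal, smul_eq_mul,
    Problem.sysRhs] at hi
  rw [Problem.residual, Problem.app2, Problem.app1, Problem.app0, div_eq_mul_inv]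
  linear_combination hi

/-- The supremum bound W and the nodal integrals are kept apart: the explicit bound estimates the
integrals through W, the asymptotic one uses their extra decay. -/
theorem abs_residual_le_of_nodal (hα : -1 / 2 < α) {M A₀ A₁ W : ℝ} {y : ℝ → ℝ}
    (hb : 0 < P.b) (hβ : P.β ≠ 0) (hp : ∀ x ∈ Ioc 0 P.b, |P.p x| ≤ M) (hsol : P.IsSolution y)
    (hy : ContDiffOn ℝ ((n + 3 : ℕ) : WithTop ℕ∞) y (Ioc 0 P.b))
    (h0 : ∀ x ∈ Ioc 0 P.b, |der P.b (n + 2) y x| ≤ A₀)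
    (h1 : ∀ x ∈ Ioc 0 P.b, |der P.b (n + 3) y x| ≤ A₁)
    (hW : ∀ x ∈ Ioc 0 P.b, |(Lagrange.nodal Finset.univ (snode P.b α n)).eval x| ≤ W)
    {Φ : Fin (n + 1) → ℝ} (hΦ : ∀ i, Φ i = der P.b 2 y (snode P.b α n i)) (i : Fin (n + 1)) :
    |P.residual α Φ i| ≤ |P.α₂| * (A₁ / (n + 1).factorial * W) +
      M * ((snode P.b α n i + |P.γ / P.β| + P.b) * (P.b * (A₁ / (n + 1).factorial * W)) +
        A₀ / n.factorial *
          (|∫ s in 0..snode P.b α n i, (Lagrange.nodal Finset.univ (snode P.b α n)).eval s| +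
           |∫ s in 0..P.b, (Lagrange.nodal Finset.univ (snode P.b α n)).eval s|)) := by
  obtain ⟨B, hB⟩ := exists_abs_der_le hb hy h1 (k := 2) (by omega)
  have hy2 : ContDiffOn ℝ (2 : ℕ) y (Ioc 0 P.b) := hy.of_le (by exact_mod_cast by omega)
  have hinj := snode_injective (n := n) hα hb
  have hmem := fun k : Fin (n + 1) => snode_mem_Ioc hα hb k
  obtain rfl : Φ = fun k => der P.b 2 y (snode P.b α n k) := funext hΦ
  set x := snode P.b α n with hx
  set f := der P.b 2 y with hf
  set I := Lagrange.interpolate Finset.univ x (fun k => f (x k)) with hI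
  set ε := A₁ / (n + 1).factorial * W with hε
  set J : ℝ → ℝ := fun t => ∫ s in 0..t, (Lagrange.nodal Finset.univ x).eval s with hJ
  have hA₁ : 0 ≤ A₁ := (abs_nonneg _).trans (h1 _ (hmem 0))
  have hM : 0 ≤ M := (abs_nonneg _).trans (hp _ (hmem 0))
  have hfI : ∀ s ∈ Ioc 0 P.b, |f s - I.eval s| ≤ ε := fun s hs =>
    (abs_sub_interpolate_le (D := fun k => der P.b (k + 2) y) hinj hmem
      (fun k hk => continuousOn_der hy (by omega))
      (fun k hk z hz => hasDerivAt_der hy (by omega) hz) h1 hs).trans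
      (mul_le_mul_of_nonneg_left (hW s hs) (by positivity))
  have hlam : |I.coeff n| ≤ A₀ / n.factorial :=
    abs_coeff_interpolate_le (D := fun k => der P.b (k + 2) y) hinj hmem
      (fun k hk => continuousOn_der hy (by omega))
      (fun k hk z hz => hasDerivAt_der hy (by omega) hz) h0
  have hε0 : 0 ≤ ε := (abs_nonneg _).trans (hfI _ (hmem 0))
  have hfint : ∀ k, IntervalIntegrable f volume 0 (x k) := fun k =>
    intervalIntegrable_of_bounded (hmem k) (continuousOn_der hy2 le_rfl) hB
  have hfint' : ∀ k, IntervalIntegrable (fun s => (x k - s) * f s) volume 0 (x k) := fun k =>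
    (hfint k).continuousOn_mul (continuous_const.sub continuous_id).continuousOn
  have hIint : ∀ k, IntervalIntegrable (fun s => I.eval s) volume 0 (x k) := fun k =>
    I.continuous.intervalIntegrable _ _
  have hIint' : ∀ k, IntervalIntegrable (fun s => (x k - s) * I.eval s) volume 0 (x k) := fun k =>
    ((continuous_const.sub continuous_id).mul I.continuous).intervalIntegrable _ _
  set e : Fin (n + 1) → ℝ := fun k => ∫ s in 0..x k, (f s - I.eval s) with he
  set E : Fin (n + 1) → ℝ := fun k => ∫ s in 0..x k, (x k - s) * (f s - I.eval s) with hE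
  have hQ1 : ∀ k, (Qb1 P.b α n).mulVec (fun k => f (x k)) k =
      der P.b 1 y (x k) - P.α₁ - e k := by
    intro k
    rw [Qb1_mulVec hb, ← integral_der_two hb hy2 hB hsol.neumann (hmem k), he]
    simp only
    rw [intervalIntegral.integral_sub (hfint k) (hIint k)]
    ring
  have hQ2 : ∀ k, (Qb2 P.b α n).mulVec (fun k => f (x k)) k =
      y (x k) - y 0 - P.α₁ * x k - E k + I.coeff n * J (x k) := by
    intro k
    rw [Qb2_mulVec hα hb, ← integral_sub_mul_der_two hb hy2 hB hsol.neumann (hmem k), hE]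
    simp only [mul_sub]
    simp only [← hx, ← hI]
    rw [intervalIntegral.integral_sub (hfint' k) (hIint' k)]
    ring
  have hx0 : x 0 = P.b := snode_zero hα
  have happ1 : P.app1 α (fun k => f (x k)) i = der P.b 1 y (x i) - e i := by
    rw [Problem.app1, hQ1]
    ring
  have happ0 : P.app0 α (fun k => f (x k)) i =
      y (x i) - E i + E 0 + P.γ / P.β * e 0 + I.coeff n * (J (x i) - J P.b) := by
    -- Subtracting row 0 removes the unknown y(0), and since x_0 = b it brings in y(b) and y'(b),
    -- which the Robin condition combines.
    have hT : (P.Theta α n).mulVec (fun k => f (x k)) i =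
        (Qb2 P.b α n).mulVec (fun k => f (x k)) i - (Qb2 P.b α n).mulVec (fun k => f (x k)) 0
          - P.γ / P.β * (Qb1 P.b α n).mulVec (fun k => f (x k)) 0 := by
      simp only [Matrix.mulVec, dotProduct, Problem.Theta, Matrix.of_apply, Finset.mul_sum,
        ← Finset.sum_sub_distrib]
      exact Finset.sum_congr rfl fun k _ => by ring
    have hrob : y P.b = P.δ / P.β - P.γ / P.β * der P.b 1 y P.b := by
      have := hsol.robin
      field_simp
      linarith
    rw [Problem.app0, hT, hQ2, hQ2, hQ1, Problem.xbar, ← hx, hx0, hrob]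
    field_simp
    ring
  have hres : P.residual α (fun k => f (x k)) i =
      -(P.α₂ / x i * e i) + P.p (x i) *
        (-E i + E 0 + P.γ / P.β * e 0 + I.coeff n * (J (x i) - J P.b)) := by
    have hode := hsol.ode (x i) (hmem i)
    rw [Problem.residual, Problem.app2, happ1, happ0, ← hx]
    linear_combination hode
  have habs_e : ∀ k, |e k| ≤ ε * x k := by
    intro k
    have h := intervalIntegral.norm_integral_le_of_norm_le_const (a := 0) (b := x k)
      (f := fun s => f s - I.eval s) (C := ε) fun s hs => by
        rw [uIoc_of_le (hmem k).1.le] at hs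
        exact hfI s ⟨hs.1, hs.2.trans (hmem k).2⟩
    rwa [sub_zero, abs_of_pos (hmem k).1] at h
  have habs_E : ∀ k, |E k| ≤ P.b * ε * x k := by
    intro k
    have h := intervalIntegral.norm_integral_le_of_norm_le_const (a := 0) (b := x k)
      (f := fun s => (x k - s) * (f s - I.eval s)) (C := P.b * ε) fun s hs => by
        rw [uIoc_of_le (hmem k).1.le] at hs
        rw [Real.norm_eq_abs, abs_mul]
        refine mul_le_mul ?_ (hfI s ⟨hs.1, hs.2.trans (hmem k).2⟩) (abs_nonneg _) hb.le
        rw [abs_le]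
        constructor <;> linarith [hs.1, hs.2, (hmem k).2]
    rwa [sub_zero, abs_of_pos (hmem k).1] at h
  rw [hres]
  refine (abs_add_le _ _).trans (add_le_add ?_ ?_)
  -- The singular factor 1/x_i is absorbed by the length x_i of the integration interval in the
  -- bound for e_i.
  · rw [abs_neg, abs_mul, abs_div, abs_of_pos (hmem i).1]
    have h := mul_le_mul_of_nonneg_left (habs_e i)
      (div_nonneg (abs_nonneg P.α₂) (hmem i).1.le)
    refine h.trans_eq ?_
    have := (hmem i).1.ne'
    field_simp
  · rw [abs_mul]
    refine mul_le_mul (hp _ (hmem i)) ?_ (abs_nonneg _) hM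
    have t1 := habs_E i
    have t2 := habs_E 0
    have t3 : |P.γ / P.β * e 0| ≤ |P.γ / P.β| * (ε * P.b) := by
      rw [abs_mul, ← hx0]
      exact mul_le_mul_of_nonneg_left (habs_e 0) (abs_nonneg _)
    have t4 : |I.coeff n * (J (x i) - J P.b)| ≤ A₀ / n.factorial * (|J (x i)| + |J P.b|) := by
      rw [abs_mul]
      exact mul_le_mul hlam (abs_sub _ _) (abs_nonneg _) ((abs_nonneg _).trans hlam)
    rw [hx0] at t2
    have := (abs_add_le (-E i + E 0 + P.γ / P.β * e 0) (I.coeff n * (J (x i) - J P.b)))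
    have := (abs_add_le (-E i + E 0) (P.γ / P.β * e 0))
    have := (abs_add_le (-E i) (E 0))
    rw [abs_neg] at this
    linarith

end Residual

/-! ### The explicit estimate of part (i). -/

section ExplicitBound

variable {α : ℝ} {n : ℕ} {P : Problem}

theorem abs_eval_radauPoly_le_supNorm (b : ℝ) {x : ℝ} (hx : x ∈ Ioc 0 b) :
    |(radauPoly α n).eval (2 * x / b - 1)| ≤
      supNorm (fun t => (radauPoly α n).eval (2 * t / b - 1)) (Ioc 0 b) := by
  have hcont : Continuous fun t : ℝ => |(radauPoly α n).eval (2 * t / b - 1)| :=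
    ((radauPoly α n).continuous.comp
      (((continuous_const.mul continuous_id).div_const b).sub continuous_const)).abs
  refine le_csSup ?_ (mem_image_of_mem _ hx)
  exact ((isCompact_Icc (a := 0) (b := b)).bddAbove_image hcont.continuousOn).mono
    (image_mono Ioc_subset_Icc_self)

theorem supNorm_nonneg (f : ℝ → ℝ) (S : Set ℝ) : 0 ≤ supNorm f S :=
  Real.sSup_nonneg (by rintro _ ⟨x, -, rfl⟩; exact abs_nonneg _)

theorem explicitBound_eq (hα : -1 / 2 < α) (M A₀ A₁ x : ℝ) :
    explicitBound P α n M A₀ A₁ x =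
      (P.b / 2) ^ (n + 1) / gegenbauerLead α n *
        supNorm (fun t => (radauPoly α n).eval (2 * t / P.b - 1)) (Ioc 0 P.b) /
        (n + 1).factorial * (A₁ * (P.b * M * (x + |P.γ / P.β| + P.b) + |P.α₂|)
          + A₀ * M * (n + 1) * (x + P.b)) := by
  have hn := Nat.cast_nonneg (α := ℝ) n
  have hG : ∀ z : ℝ, 0 < z → Real.Gamma z ≠ 0 := fun z hz => (Real.Gamma_pos_of_pos hz).ne'
  have g1 := hG (α + 1) (by linarith)
  have g2 := hG (n + 2 * α + 1) (by linarith)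
  have g3 := hG (2 * α + 1) (by linarith)
  have g4 := hG (n + α + 1) (by linarith)
  rw [explicitBound, gegenbauerLead_eq_Gamma hα]
  congr 1
  have h2 : (2 : ℝ) ^ (-2 * (n : ℤ) - 1) = 1 / (2 ^ (n + 1) * 2 ^ n) := by
    rw [← pow_add, one_div, ← zpow_natCast, ← zpow_neg]
    congr 1
    push_cast
    ring
  rw [h2, div_pow]
  field_simp

theorem abs_residual_le_explicitBound (hα : -1 / 2 < α) {M A₀ A₁ : ℝ} {y : ℝ → ℝ}
    (hb : 0 < P.b) (hβ : P.β ≠ 0) (hp : ∀ x ∈ Ioc 0 P.b, |P.p x| ≤ M) (hsol : P.IsSolution y)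
    (hy : ContDiffOn ℝ ((n + 3 : ℕ) : WithTop ℕ∞) y (Ioc 0 P.b))
    (h0 : ∀ x ∈ Ioc 0 P.b, |der P.b (n + 2) y x| ≤ A₀)
    (h1 : ∀ x ∈ Ioc 0 P.b, |der P.b (n + 3) y x| ≤ A₁)
    (Φ : Fin (n + 1) → ℝ) (hΦ : P.IsNodalVector α y Φ) (i : Fin (n + 1)) :
    |P.residual α Φ i| ≤ explicitBound P α n M A₀ A₁ (snode P.b α n i) := by
  have hmem := fun k : Fin (n + 1) => snode_mem_Ioc hα hb k
  have hA₁ : 0 ≤ A₁ := (abs_nonneg _).trans (h1 _ (hmem 0))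
  have hA₀ : 0 ≤ A₀ := (abs_nonneg _).trans (h0 _ (hmem 0))
  have hM : 0 ≤ M := (abs_nonneg _).trans (hp _ (hmem 0))
  have hK := gegenbauerLead_pos hα n
  have hxi := (hmem i).1
  rw [explicitBound_eq hα]
  set S := supNorm (fun t => (radauPoly α n).eval (2 * t / P.b - 1)) (Ioc 0 P.b)
  have hS : 0 ≤ S := supNorm_nonneg _ _
  set W := (P.b / 2) ^ (n + 1) / gegenbauerLead α n * S with hWdef
  have hW0 : 0 ≤ W := by positivity
  rcases hΦ with hΦ | hΦ
  swap
  · rw [residual_eq_zero_of_system hΦ, abs_zero]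
    positivity
  have hW : ∀ x ∈ Ioc 0 P.b, |(Lagrange.nodal Finset.univ (snode P.b α n)).eval x| ≤ W := by
    intro x hx
    rw [eval_nodal_snode hα hb, abs_mul, abs_of_nonneg (by positivity), div_mul_eq_mul_div 2 P.b x]
    exact mul_le_mul_of_nonneg_left (abs_eval_radauPoly_le_supNorm P.b hx) (by positivity)
  have hJ : ∀ x ∈ Ioc 0 P.b,
      |∫ s in 0..x, (Lagrange.nodal Finset.univ (snode P.b α n)).eval s| ≤ W * x := by
    intro x hx
    have h := intervalIntegral.norm_integral_le_of_norm_le_const (a := 0) (b := x)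
      (f := fun s => (Lagrange.nodal Finset.univ (snode P.b α n)).eval s) (C := W) fun s hs => by
        rw [uIoc_of_le hx.1.le] at hs
        exact hW s ⟨hs.1, hs.2.trans hx.2⟩
    rwa [sub_zero, abs_of_pos hx.1] at h
  refine (abs_residual_le_of_nodal hα hb hβ hp hsol hy h0 h1 hW hΦ i).trans ?_
  have hJi := hJ _ (hmem i)
  have hJb := hJ P.b ⟨hb, le_rfl⟩
  calc _ ≤ |P.α₂| * (A₁ / (n + 1).factorial * W) +
      M * ((snode P.b α n i + |P.γ / P.β| + P.b) * (P.b * (A₁ / (n + 1).factorial * W)) +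
        A₀ / n.factorial * (W * snode P.b α n i + W * P.b)) := by gcongr
    _ = _ := by
        rw [Nat.factorial_succ]
        push_cast
        field_simp
        ring

end ExplicitBound

/-! ### Decay of the nodal integrals, growth of the leading coefficient, and the rate of part (ii).
-/

section Asymptotics

variable {α : ℝ}

theorem integral_gegenbauer (hα : -1 / 2 < α) (m : ℕ) (t : ℝ) :
    2 * (m + 2 + α) * ∫ x in (-1 : ℝ)..t, (gegenbauer α (m + 2)).eval x =
      (((m : ℝ) + 2 + 2 * α) / (m + 3) * (gegenbauer α (m + 3)).eval t
        - ((m : ℝ) + 2) / (m + 1 + 2 * α) * (gegenbauer α (m + 1)).eval t)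
      - (((m : ℝ) + 2 + 2 * α) / (m + 3) * (gegenbauer α (m + 3)).eval (-1)
        - ((m : ℝ) + 2) / (m + 1 + 2 * α) * (gegenbauer α (m + 1)).eval (-1)) := by
  rw [← intervalIntegral.integral_const_mul]
  have h := fun x => Polynomial.hasDerivAt (C (((m : ℝ) + 2 + 2 * α) / (m + 3)) *
    gegenbauer α (m + 3) - C (((m : ℝ) + 2) / (m + 1 + 2 * α)) * gegenbauer α (m + 1)) x
  simp only [derivative_gegenbauer_sub hα, eval_mul, eval_sub, eval_C] at h
  exact intervalIntegral.integral_eq_sub_of_hasDerivAt (fun x _ => h x)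
    ((continuous_const.mul (Polynomial.continuous _)).intervalIntegrable _ _)

theorem abs_integral_gegenbauer_le (hα : -1 / 2 < α) (m : ℕ) {B : ℝ}
    (h1 : ∀ x ∈ Icc (-1 : ℝ) 1, |(gegenbauer α (m + 1)).eval x| ≤ B)
    (h3 : ∀ x ∈ Icc (-1 : ℝ) 1, |(gegenbauer α (m + 3)).eval x| ≤ B)
    {t : ℝ} (ht : t ∈ Icc (-1 : ℝ) 1) :
    |∫ x in (-1 : ℝ)..t, (gegenbauer α (m + 2)).eval x| ≤
      2 * (2 + 2 * |α| + 2 / (1 + 2 * α)) * B / (m + 1) := by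
  have hm := Nat.cast_nonneg (α := ℝ) m
  have hd : 0 < 1 + 2 * α := by linarith
  -- Dominates both coefficients of the antiderivative for every m; the last summand covers
  -- (m+2)/(m+1+2α), whose value at m = 0 is 2/(1+2α).
  set c := 2 + 2 * |α| + 2 / (1 + 2 * α) with hc
  have hfrac : 0 < 2 / (1 + 2 * α) := by positivity
  have habs := abs_nonneg α
  have hleabs := le_abs_self α
  have hm1 : (0 : ℝ) < m + 1 + 2 * α := by linarith
  have ha : |((m : ℝ) + 2 + 2 * α) / (m + 3)| ≤ c := by
    rw [abs_of_nonneg (div_nonneg (by linarith) (by linarith)), div_le_iff₀ (by linarith)]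
    nlinarith
  have hcc : |((m : ℝ) + 2) / (m + 1 + 2 * α)| ≤ c := by
    rw [abs_of_nonneg (by positivity), div_le_iff₀ hm1]
    have e1 : 2 / (1 + 2 * α) * (1 + 2 * α) = 2 := div_mul_cancel₀ _ hd.ne'
    have e2 : 0 ≤ 2 / (1 + 2 * α) * m := by positivity
    have e3 : 0 ≤ 2 * |α| * (m + 1 + 2 * α) := by positivity
    rw [hc]
    linarith
  have hm1' : (-1 : ℝ) ∈ Icc (-1 : ℝ) 1 := by norm_num
  have hB : 0 ≤ B := (abs_nonneg _).trans (h1 _ hm1')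
  have hterm : ∀ z ∈ Icc (-1 : ℝ) 1,
      |((m : ℝ) + 2 + 2 * α) / (m + 3) * (gegenbauer α (m + 3)).eval z
        - ((m : ℝ) + 2) / (m + 1 + 2 * α) * (gegenbauer α (m + 1)).eval z| ≤ 2 * (c * B) := by
    intro z hz
    have f1 := mul_le_mul ha (h3 z hz) (abs_nonneg _) (by positivity)
    have f2 := mul_le_mul hcc (h1 z hz) (abs_nonneg _) (by positivity)
    rw [← abs_mul] at f1 f2
    linarith [abs_sub (((m : ℝ) + 2 + 2 * α) / (m + 3) * (gegenbauer α (m + 3)).eval z)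
      (((m : ℝ) + 2) / (m + 1 + 2 * α) * (gegenbauer α (m + 1)).eval z)]
  have hI := congrArg abs (integral_gegenbauer hα m t)
  have hpos : (0 : ℝ) < 2 * (m + 2 + α) := by linarith
  rw [abs_mul, abs_of_pos hpos] at hI
  have hsum := (abs_sub _ _).trans (add_le_add (hterm t ht) (hterm _ hm1'))
  rw [← hI] at hsum
  rw [le_div_iff₀ (by positivity)]
  have : |∫ x in (-1 : ℝ)..t, (gegenbauer α (m + 2)).eval x| * (m + 1) ≤
      |∫ x in (-1 : ℝ)..t, (gegenbauer α (m + 2)).eval x| * (m + 2 + α) :=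
    mul_le_mul_of_nonneg_left (by linarith) (abs_nonneg _)
  linarith

theorem exists_radauPoly_bounds (hα : -1 / 2 < α) {D : ℝ} (hD : 0 < D) (σ : ℕ)
    (h : ∀ n : ℕ, ∀ x ∈ Icc (-1 : ℝ) 1, |(gegenbauer α n).eval x| ≤ D * (n + 1) ^ σ) :
    ∃ c : ℝ, 0 < c ∧ ∀ n : ℕ, 2 ≤ n → ∀ t ∈ Icc (-1 : ℝ) 1,
      |(radauPoly α n).eval t| ≤ c * (n : ℝ) ^ σ ∧
      |∫ x in (-1 : ℝ)..t, (radauPoly α n).eval x| ≤ c * (n : ℝ) ^ σ / n := by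
  have hd : 0 < 1 + 2 * α := by linarith
  set c₁ := 2 + 2 * |α| + 2 / (1 + 2 * α) with hc₁
  have hc₁2 : 2 ≤ c₁ := by
    have : 0 < 2 / (1 + 2 * α) := by positivity
    linarith [abs_nonneg α]
  -- 3^σ comes from k + 1 ≤ 3n for k ≤ n + 2, and 8 from two integrals, each at most 2c₁B/(n-1) ≤
  -- 4c₁B/n.
  refine ⟨8 * c₁ * (D * 3 ^ σ), by positivity, fun n hn t ht => ?_⟩
  obtain ⟨l, rfl⟩ := Nat.exists_eq_add_of_le' hn
  have hl := Nat.cast_nonneg (α := ℝ) l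
  have hB : ∀ k ≤ l + 4, ∀ x ∈ Icc (-1 : ℝ) 1,
      |(gegenbauer α k).eval x| ≤ D * 3 ^ σ * ((l + 2 : ℕ) : ℝ) ^ σ := by
    intro k hk x hx
    refine (h k x hx).trans ?_
    rw [mul_assoc, ← mul_pow]
    have hk' : (k : ℝ) ≤ l + 4 := by exact_mod_cast hk
    have : (k : ℝ) + 1 ≤ 3 * ((l + 2 : ℕ) : ℝ) := by
      push_cast
      linarith
    gcongr
  set B := D * 3 ^ σ * ((l + 2 : ℕ) : ℝ) ^ σ with hBdef
  have hB0 : 0 ≤ B := by positivity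
  constructor
  · rw [radauPoly, eval_sub]
    have := abs_sub ((gegenbauer α (l + 2 + 1)).eval t) ((gegenbauer α (l + 2)).eval t)
    have h1 := hB (l + 2 + 1) (by omega) t ht
    have h2 := hB (l + 2) (by omega) t ht
    calc _ ≤ 2 * B := by linarith
      _ ≤ 8 * c₁ * B := by nlinarith
      _ = _ := by rw [hBdef]; ring
  · simp only [radauPoly, eval_sub]
    rw [intervalIntegral.integral_sub ((Polynomial.continuous _).intervalIntegrable _ _)
      ((Polynomial.continuous _).intervalIntegrable _ _)]
    have h1 := abs_integral_gegenbauer_le hα (l + 1) (hB (l + 2) (by omega))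
      (hB (l + 4) (by omega)) ht
    have h2 := abs_integral_gegenbauer_le hα l (hB (l + 1) (by omega)) (hB (l + 3) (by omega)) ht
    rw [← hc₁] at h1 h2
    refine (abs_sub _ _).trans ((add_le_add h1 h2).trans ?_)
    have hx : 0 ≤ 2 * c₁ * B := by positivity
    have h3 : 2 * c₁ * B / (((l + 1 : ℕ) : ℝ) + 1) ≤ 2 * c₁ * B / (l + 1) := by
      push_cast
      gcongr
      linarith
    have h4 : 2 * c₁ * B / ((l : ℝ) + 1) ≤ 4 * c₁ * B / ((l + 2 : ℕ) : ℝ) := by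
      push_cast
      rw [div_le_div_iff₀ (by positivity) (by positivity)]
      nlinarith
    calc _ ≤ 4 * c₁ * B / ((l + 2 : ℕ) : ℝ) + 4 * c₁ * B / ((l + 2 : ℕ) : ℝ) := by linarith
      _ = _ := by rw [hBdef]; ring

/-- Each inverted factor is ½(1 + α/(m+1+α)) ≤ ½ exp(α/(m+1)) for either sign of α, so the product
is governed by α H_n. Since H_n lies between log n and 1 + log n, the error costs at most e^|α|. -/
theorem inv_gegenbauerLead_le (hα : -1 / 2 < α) {n : ℕ} (hn : 1 ≤ n) :
    (gegenbauerLead α n)⁻¹ ≤ Real.exp |α| * (1 / 2) ^ n * (n : ℝ) ^ α := by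
  have hn0 : (0 : ℝ) < n := by exact_mod_cast hn
  have h1 : (gegenbauerLead α n)⁻¹ ≤
      ∏ m ∈ Finset.range n, (1 / 2 * Real.exp (α * ((m : ℝ) + 1)⁻¹)) := by
    rw [gegenbauerLead, ← Finset.prod_inv_distrib]
    refine Finset.prod_le_prod (fun m _ => ?_) fun m _ => ?_
    all_goals have hm := Nat.cast_nonneg (α := ℝ) m
    · exact inv_nonneg.2 (div_nonneg (by linarith) (by linarith))
    · have hp : (0 : ℝ) < m + 1 + α := by linarith
      have hp' : (0 : ℝ) < m + 1 + 2 * α := by linarith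
      have e1 : (2 * ((m : ℝ) + 1 + α) / (m + 1 + 2 * α))⁻¹ =
          1 / 2 * (α / (m + 1 + α) + 1) := by
        field_simp
        ring
      have e2 : α / (m + 1 + α) ≤ α * ((m : ℝ) + 1)⁻¹ := by
        rw [← div_eq_mul_inv, div_le_div_iff₀ hp (by positivity)]
        nlinarith [sq_nonneg α]
      rw [e1]
      have := Real.add_one_le_exp (α * ((m : ℝ) + 1)⁻¹)
      linarith
  refine h1.trans ?_
  rw [Finset.prod_mul_distrib, Finset.prod_const, Finset.card_range, ← Real.exp_sum,
    ← Finset.mul_sum, mul_comm (Real.exp |α|), mul_assoc]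
  refine mul_le_mul_of_nonneg_left ?_ (by positivity)
  rw [Real.rpow_def_of_pos hn0, ← Real.exp_add]
  refine Real.exp_le_exp.2 ?_
  have hH : ∑ m ∈ Finset.range n, ((m : ℝ) + 1)⁻¹ = (harmonic n : ℝ) := by
    simp [harmonic]
  have hup := harmonic_le_one_add_log n
  have hlow : Real.log n ≤ harmonic n :=
    (Real.log_le_log hn0 (by push_cast; linarith)).trans (log_add_one_le_harmonic n)
  rw [hH]
  rcases le_total 0 α with h | h
  · rw [abs_of_nonneg h]
    nlinarith
  · rw [abs_of_nonpos h]
    nlinarith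

theorem inv_factorial_le {n : ℕ} (hn : 1 ≤ n) :
    ((n.factorial : ℝ))⁻¹ ≤ Real.exp 1 ^ n * (n : ℝ) ^ (-(n : ℝ) - 1 / 2) := by
  have hn0 : (0 : ℝ) < n := by exact_mod_cast hn
  have h := Stirling.le_factorial_stirling n
  have h1 : √(n : ℝ) ≤ √(2 * Real.pi * n) := by
    refine Real.sqrt_le_sqrt ?_
    nlinarith [Real.pi_gt_three]
  have h2 : √(n : ℝ) * (n / Real.exp 1) ^ n ≤ n.factorial :=
    (mul_le_mul_of_nonneg_right h1 (by positivity)).trans h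
  refine (inv_anti₀ (by positivity) h2).trans_eq ?_
  rw [Real.rpow_sub hn0, Real.rpow_neg hn0.le, Real.rpow_natCast, ← Real.sqrt_eq_rpow, div_pow]
  field_simp

/-- Both contributions carry W/(n! n): the A₁ terms because (n+1)! ≥ n · n!, the A₀ term because the
nodal integrals are smaller than W by a factor of order n. Chosen before the problem, c leaves the
data visible in one prefactor. -/
theorem exists_abs_residual_le (hα : -1 / 2 < α) {D : ℝ} (hD : 0 < D) (σ : ℕ)
    (h : ∀ n : ℕ, ∀ x ∈ Icc (-1 : ℝ) 1, |(gegenbauer α n).eval x| ≤ D * (n + 1) ^ σ) :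
    ∃ c : ℝ, 0 < c ∧ ∀ (P : Problem) (M A₀ A₁ : ℝ) (y : ℝ → ℝ) (n : ℕ), 2 ≤ n →
      0 < P.b → P.β ≠ 0 → (∀ x ∈ Ioc 0 P.b, |P.p x| ≤ M) → P.IsSolution y →
      ContDiffOn ℝ ((n + 3 : ℕ) : WithTop ℕ∞) y (Ioc 0 P.b) →
      (∀ x ∈ Ioc 0 P.b, |der P.b (n + 2) y x| ≤ A₀) →
      (∀ x ∈ Ioc 0 P.b, |der P.b (n + 3) y x| ≤ A₁) →
      ∀ Φ : Fin (n + 1) → ℝ, P.IsNodalVector α y Φ → ∀ i : Fin (n + 1),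
        |P.residual α Φ i| ≤ c * (|P.α₂| * A₁ +
            M * ((P.b + |P.γ / P.β| + P.b) * (P.b * A₁) + A₀ * P.b)) *
          ((Real.exp 1 / 4) ^ n * P.b ^ (n + 1) *
            (n : ℝ) ^ (-(n : ℝ) - 1 / 2 + (α + σ - 1))) := by
  obtain ⟨c, hc, hq⟩ := exists_radauPoly_bounds hα hD σ h
  refine ⟨c * Real.exp |α| / 2, by positivity, ?_⟩
  intro P M A₀ A₁ y n hn hb hβ hp hsol hy h0 h1 Φ hΦ i
  have hn0 : (0 : ℝ) < n := by exact_mod_cast (by omega : 0 < n)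
  have hmem := fun k : Fin (n + 1) => snode_mem_Ioc hα hb k
  have hA₁ : 0 ≤ A₁ := (abs_nonneg _).trans (h1 _ (hmem 0))
  have hA₀ : 0 ≤ A₀ := (abs_nonneg _).trans (h0 _ (hmem 0))
  have hM : 0 ≤ M := (abs_nonneg _).trans (hp _ (hmem 0))
  have hK := gegenbauerLead_pos hα n
  rcases hΦ with hΦ | hΦ
  swap
  · rw [residual_eq_zero_of_system hΦ, abs_zero]
    positivity
  set W := (P.b / 2) ^ (n + 1) / gegenbauerLead α n * (c * (n : ℝ) ^ σ) with hWdef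
  have hW0 : 0 ≤ W := by positivity
  have hW : ∀ x ∈ Ioc 0 P.b, |(Lagrange.nodal Finset.univ (snode P.b α n)).eval x| ≤ W := by
    intro x hx
    rw [eval_nodal_snode hα hb, abs_mul, abs_of_nonneg (by positivity)]
    refine mul_le_mul_of_nonneg_left (hq n hn _ ?_).1 (by positivity)
    rw [div_mul_eq_mul_div]
    constructor
    · have : 0 ≤ 2 * x / P.b := div_nonneg (by linarith [hx.1]) hb.le
      linarith
    · have : 2 * x / P.b ≤ 2 := by
        rw [div_le_iff₀ hb]
        linarith [hx.2]
      linarith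
  have hJ : ∀ k : Fin (n + 1),
      |∫ s in 0..snode P.b α n k, (Lagrange.nodal Finset.univ (snode P.b α n)).eval s| ≤
        W * (P.b / 2) / n := by
    intro k
    rw [integral_nodal_snode hα hb, abs_mul, abs_of_nonneg (by positivity)]
    refine (mul_le_mul_of_nonneg_left (hq n hn _ (Ioc_subset_Icc_self (node_mem_Ioc hα n k))).2
      (by positivity)).trans_eq ?_
    rw [hWdef]
    ring
  have hJb := hJ 0
  rw [snode_zero hα] at hJb
  refine (abs_residual_le_of_nodal hα hb hβ hp hsol hy h0 h1 hW hΦ i).trans ?_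
  have hfac : A₁ / (n + 1).factorial * W ≤ A₁ * (W / n.factorial / n) := by
    rw [Nat.factorial_succ, div_mul_eq_mul_div, mul_div_assoc]
    refine mul_le_mul_of_nonneg_left ?_ hA₁
    rw [div_div]
    refine div_le_div_of_nonneg_left hW0 (by positivity) ?_
    push_cast
    have := (Nat.cast_nonneg (α := ℝ) n.factorial)
    nlinarith
  have hT : W / n.factorial / n ≤ c * Real.exp |α| / 2 * ((Real.exp 1 / 4) ^ n * P.b ^ (n + 1) *
      (n : ℝ) ^ (-(n : ℝ) - 1 / 2 + (α + σ - 1))) := by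
    rw [Real.rpow_add hn0, show α + (σ : ℝ) - 1 = α + ((σ : ℝ) - 1) by ring, Real.rpow_add hn0,
      Real.rpow_sub_one hn0.ne', Real.rpow_natCast]
    calc W / n.factorial / n = (P.b / 2) ^ (n + 1) * (c * (n : ℝ) ^ σ / n) *
          ((gegenbauerLead α n)⁻¹ * (n.factorial : ℝ)⁻¹) := by
          rw [hWdef]
          ring
      _ ≤ (P.b / 2) ^ (n + 1) * (c * (n : ℝ) ^ σ / n) *
          ((Real.exp |α| * (1 / 2) ^ n * (n : ℝ) ^ α) *
            (Real.exp 1 ^ n * (n : ℝ) ^ (-(n : ℝ) - 1 / 2))) := by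
          refine mul_le_mul_of_nonneg_left ?_ (by positivity)
          exact mul_le_mul (inv_gegenbauerLead_le hα (by omega)) (inv_factorial_le (by omega))
            (by positivity) (by positivity)
      _ = _ := by
          -- e^n comes from Stirling, one power of 1/2 from the leading coefficient and the other
          -- from (b/2)^(n+1), whose spare 1/2 sits in the constant.
          have h4 : (Real.exp 1 / 4) ^ n = Real.exp 1 ^ n * (1 / 2) ^ n * (1 / 2) ^ n := by
            rw [← mul_pow, ← mul_pow]
            congr 1
            ring
          rw [h4]
          ring
  have hxb := (hmem i).2
  calc _ ≤ |P.α₂| * (A₁ * (W / n.factorial / n)) +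
      M * ((P.b + |P.γ / P.β| + P.b) * (P.b * (A₁ * (W / n.factorial / n))) +
        A₀ / n.factorial * (W * (P.b / 2) / n + W * (P.b / 2) / n)) := by
        gcongr
        exact hJ i
    _ = (|P.α₂| * A₁ + M * ((P.b + |P.γ / P.β| + P.b) * (P.b * A₁) + A₀ * P.b)) *
        (W / n.factorial / n) := by ring
    _ ≤ (|P.α₂| * A₁ + M * ((P.b + |P.γ / P.β| + P.b) * (P.b * A₁) + A₀ * P.b)) *
        (c * Real.exp |α| / 2 * ((Real.exp 1 / 4) ^ n * P.b ^ (n + 1) *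
          (n : ℝ) ^ (-(n : ℝ) - 1 / 2 + (α + σ - 1)))) :=
        mul_le_mul_of_nonneg_left hT (by positivity)
    _ = _ := by ring

/-- If `G_n = O(n ^ σ)` uniformly on `[-1, 1]` and `α + σ - 1 < ρ`, then the residual is of smaller
order than the stated rate: the contribution of `A₀` carries the integral of `q_n` over `[-1, t]`,
which is smaller than `q_n` by a factor `n`, and if `A₀ = 0` the residual vanishes for large `n`.
Hence the constant in the rate can be taken to be `1`. -/
theorem eventually_abs_residual_le (hα : -1 / 2 < α) {D : ℝ} (hD : 0 < D) (σ : ℕ)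
    (h : ∀ n : ℕ, ∀ x ∈ Icc (-1 : ℝ) 1, |(gegenbauer α n).eval x| ≤ D * (n + 1) ^ σ)
    {ρ : ℝ} (hρ : α + σ - 1 < ρ) {b M : ℝ} (hb : 0 < b) (P : Problem) (A₀ A₁ : ℝ) (y : ℝ → ℝ)
    (hPb : P.b = b) (hβ : P.β ≠ 0) (hp : ∀ x ∈ Ioc 0 P.b, |P.p x| ≤ M) (hsol : P.IsSolution y)
    (hy : ContDiffOn ℝ ((⊤ : ℕ∞) : WithTop ℕ∞) y (Ioc 0 P.b))
    (hder : ∀ᶠ n : ℕ in atTop, (∀ x ∈ Ioc 0 P.b, |der P.b (n + 2) y x| ≤ A₀) ∧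
      (∀ x ∈ Ioc 0 P.b, |der P.b (n + 3) y x| ≤ A₁)) :
    ∀ᶠ n : ℕ in atTop, ∀ Φ : Fin (n + 1) → ℝ, P.IsNodalVector α y Φ → ∀ i : Fin (n + 1),
      (A₀ = 0 → |P.residual α Φ i| ≤ 1 * (Real.exp 1 / 4) ^ n * b ^ (n + 1) *
        (n : ℝ) ^ (-(n : ℝ) - 3 / 2 + ρ)) ∧
      (A₀ ≠ 0 → |P.residual α Φ i| ≤ 1 * (Real.exp 1 / 4) ^ n * b ^ (n + 1) *
        (n : ℝ) ^ (-(n : ℝ) - 1 / 2 + ρ)) := by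
  subst hPb
  obtain ⟨c, hc, hres⟩ := exists_abs_residual_le hα hD σ h
  set Z := c * (|P.α₂| * A₁ + M * ((P.b + |P.γ / P.β| + P.b) * (P.b * A₁) + A₀ * P.b))
  have hlim : Tendsto (fun n : ℕ => Z * (n : ℝ) ^ (-(ρ - (α + σ - 1)))) atTop (nhds 0) := by
    have := ((tendsto_rpow_neg_atTop (sub_pos.2 hρ)).comp
      tendsto_natCast_atTop_atTop).const_mul Z
    rwa [mul_zero] at this
  have hsmall := hlim.eventually (Iio_mem_nhds one_pos)
  -- Shifted by one index, the A₀ bound also covers y^(n+3). When A₀ = 0 the explicit bound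
  -- therefore applies with zero in place of A₁, whatever A₁ is.
  have hder' := (tendsto_add_atTop_nat 1).eventually hder
  filter_upwards [hder, hder', hsmall, eventually_ge_atTop 2] with n hn hn' hZ hn2 Φ hΦ i
  have hyn : ContDiffOn ℝ ((n + 3 : ℕ) : WithTop ℕ∞) y (Ioc 0 P.b) :=
    contDiffOn_infty.1 hy (n + 3)
  have hn0 : (0 : ℝ) < n := by exact_mod_cast (by omega : 0 < n)
  constructor
  · intro hA
    subst hA
    have hle := abs_residual_le_explicitBound hα hb hβ hp hsol hyn hn.1
      (fun x hx => hn'.1 x hx) Φ hΦ i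
    have hzero : explicitBound P α n M 0 0 (snode P.b α n i) = 0 := by
      simp [explicitBound]
    rw [hzero] at hle
    exact hle.trans (by positivity)
  · intro _
    refine (hres P M A₀ A₁ y n hn2 hb hβ hp hsol hyn hn.1 hn.2 Φ hΦ i).trans ?_
    have hsplit : (n : ℝ) ^ (-(n : ℝ) - 1 / 2 + (α + σ - 1)) =
        (n : ℝ) ^ (-(n : ℝ) - 1 / 2 + ρ) * (n : ℝ) ^ (-(ρ - (α + σ - 1))) := by
      rw [← Real.rpow_add hn0]
      congr 1
      ring
    rw [hsplit]
    have hR : 0 ≤ (Real.exp 1 / 4) ^ n * P.b ^ (n + 1) * (n : ℝ) ^ (-(n : ℝ) - 1 / 2 + ρ) := by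
      positivity
    have := mul_le_mul_of_nonneg_right (le_of_lt hZ) hR
    calc _ = Z * (n : ℝ) ^ (-(ρ - (α + σ - 1))) *
        ((Real.exp 1 / 4) ^ n * P.b ^ (n + 1) * (n : ℝ) ^ (-(n : ℝ) - 1 / 2 + ρ)) := by ring
      _ ≤ _ := by linarith

end Asymptotics
end SGIPSM

/-! ### Assembly: growth exponent and rate in the two parameter ranges. -/

theorem mainTheorem6 (α : ℝ) (hα : -1 / 2 < α) :
    -- the explicit bound
    (∀ (P : SGIPSM.Problem) (M A₀ A₁ : ℝ) (y : ℝ → ℝ) (n : ℕ),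
      0 < P.b → P.β ≠ 0 →
      (∀ x ∈ Set.Ioc 0 P.b, |P.p x| ≤ M) →
      P.IsSolution y →
      ContDiffOn ℝ ((n + 3 : ℕ) : WithTop ℕ∞) y (Set.Ioc 0 P.b) →
      (∀ x ∈ Set.Ioc 0 P.b, |SGIPSM.der P.b (n + 2) y x| ≤ A₀) →
      (∀ x ∈ Set.Ioc 0 P.b, |SGIPSM.der P.b (n + 3) y x| ≤ A₁) →
      ∀ Φ : Fin (n + 1) → ℝ, P.IsNodalVector α y Φ → ∀ i : Fin (n + 1),
        |P.residual α Φ i| ≤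
          SGIPSM.explicitBound P α n M A₀ A₁ (SGIPSM.snode P.b α n i)) ∧
    -- the asymptotic bound for nonnegative parameters
    (0 ≤ α → ∀ b M : ℝ, 0 < b → 0 ≤ M → ∃ L₁ : ℝ, 0 < L₁ ∧
      ∀ (P : SGIPSM.Problem) (A₀ A₁ : ℝ) (y : ℝ → ℝ),
        P.b = b → P.β ≠ 0 →
        (∀ x ∈ Set.Ioc 0 P.b, |P.p x| ≤ M) →
        P.IsSolution y →
        ContDiffOn ℝ ((⊤ : ℕ∞) : WithTop ℕ∞) y (Set.Ioc 0 P.b) →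
        (∀ᶠ n : ℕ in Filter.atTop,
          (∀ x ∈ Set.Ioc 0 P.b, |SGIPSM.der P.b (n + 2) y x| ≤ A₀) ∧
          (∀ x ∈ Set.Ioc 0 P.b, |SGIPSM.der P.b (n + 3) y x| ≤ A₁)) →
        ∀ᶠ n : ℕ in Filter.atTop,
          ∀ Φ : Fin (n + 1) → ℝ, P.IsNodalVector α y Φ → ∀ i : Fin (n + 1),
            (A₀ = 0 → |P.residual α Φ i| ≤
              L₁ * (Real.exp 1 / 4) ^ n * b ^ (n + 1) *
                (n : ℝ) ^ (-(n : ℝ) - 3 / 2 + α)) ∧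
            (A₀ ≠ 0 → |P.residual α Φ i| ≤
              L₁ * (Real.exp 1 / 4) ^ n * b ^ (n + 1) *
                (n : ℝ) ^ (-(n : ℝ) - 1 / 2 + α))) ∧
    -- the asymptotic bound for negative parameters
    (α < 0 → ∀ b M : ℝ, 0 < b → 0 ≤ M → ∃ L₂ : ℝ, 0 < L₂ ∧
      ∀ (P : SGIPSM.Problem) (A₀ A₁ : ℝ) (y : ℝ → ℝ),
        P.b = b → P.β ≠ 0 →
        (∀ x ∈ Set.Ioc 0 P.b, |P.p x| ≤ M) →
        P.IsSolution y →
        ContDiffOn ℝ ((⊤ : ℕ∞) : WithTop ℕ∞) y (Set.Ioc 0 P.b) →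
        (∀ᶠ n : ℕ in Filter.atTop,
          (∀ x ∈ Set.Ioc 0 P.b, |SGIPSM.der P.b (n + 2) y x| ≤ A₀) ∧
          (∀ x ∈ Set.Ioc 0 P.b, |SGIPSM.der P.b (n + 3) y x| ≤ A₁)) →
        ∀ᶠ n : ℕ in Filter.atTop,
          ∀ Φ : Fin (n + 1) → ℝ, P.IsNodalVector α y Φ → ∀ i : Fin (n + 1),
            (A₀ = 0 → |P.residual α Φ i| ≤
              L₂ * (Real.exp 1 / 4) ^ n * b ^ (n + 1) *
                (n : ℝ) ^ (-(n : ℝ) - 3 / 2)) ∧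
            (A₀ ≠ 0 → |P.residual α Φ i| ≤
              L₂ * (Real.exp 1 / 4) ^ n * b ^ (n + 1) *
                (n : ℝ) ^ (-(n : ℝ) - 1 / 2))) := by

  refine ⟨fun P M A₀ A₁ y n hb hβ hp hsol hy h0 h1 Φ hΦ i =>
    SGIPSM.abs_residual_le_explicitBound hα hb hβ hp hsol hy h0 h1 Φ hΦ i, ?_, ?_⟩
  · intro h0 b M hb _
    refine ⟨1, one_pos, fun P A₀ A₁ y hPb hβ hp hsol hy hder => ?_⟩
    -- Here σ = 0 and ρ = α, so the gap in the exponent is a full power of n.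
    exact SGIPSM.eventually_abs_residual_le hα one_pos 0
      (fun n x hx => by simpa using SGIPSM.abs_gegenbauer_le_one h0 n x hx)
      (by norm_num) hb P A₀ A₁ y hPb hβ hp hsol hy hder
  · intro h0 b M hb _
    obtain ⟨D, hD, hG⟩ := SGIPSM.exists_abs_gegenbauer_le hα h0
    refine ⟨1, one_pos, fun P A₀ A₁ y hPb hβ hp hsol hy hder => ?_⟩
    -- Here σ = 1 and ρ = 0: the required α + σ - 1 < ρ is exactly α < 0.
    have := SGIPSM.eventually_abs_residual_le hα hD 1
      (fun n x hx => by simpa using hG n x hx) (ρ := 0) (by simpa using h0) hb P A₀ A₁ y hPb hβ hp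
      hsol hy hder
    simpa only [add_zero] using this
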